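/- **Theorem 4.5.** Let $(R,\mathfrak m)$ be a Cohen–Macaulay (Noetherian) local ring of dimension $d\in\{1,2\}$ with infinite residue field, let $s\ge 1$, and let $I_1,\dots,I_s$ be $\mathfrak m$-primary ideals of $R$. For $n=(n_1,\dots,n_s)\in\mathbb Z^s$ put $\underline I^{n}=I_1^{n_1}\cdots I_s^{n_s}$, where $I_i^{n_i}=R$ if $n_i\le 0$, and $n^+=(\max(n_1,0),\dots,\max(n_s,0))$; order $\mathbb Z^s$ componentwise and let $e_1,\dots,e_s$ be its standard basis vectors. Let $\mathcal F=\{\mathcal F(n)\}_{n\in\mathbb Z^s}$ be an $\underline I$-admissible filtration, i.e. a family of ideals of $R$ such that for all $m,n\in\mathbb Z^s$: $\underline I^{n}\subseteq\mathcal F(n)$; $\mathcal F(n)\mathcal F(m)\subseteq\mathcal F(n+m)$; $\mathcal F(m)\subseteq\mathcal F(n)$ if $m\ge n$; $\mathcal F(n)=\mathcal F(n^+)$; and $\bigoplus_{n\in\mathbb Z^s}\mathcal F(n)t^n$ is a finite module over $\bigoplus_{n\in\mathbb Z^s}\underline I^{n}t^n$, where $t^n=t_1^{n_1}\cdots t_s^{n_s}$.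 Let $H_{\mathcal F}(n)=\lambda(R/\mathcal F(n))$ (length) be the Hilbert function of $\mathcal F$, and let $$P_{\mathcal F}(n)=\sum_{\alpha\in\mathbb N^s,\ |\alpha|\le d}(-1)^{d-|\alpha|}e_\alpha(\mathcal F)\binom{n_1+\alpha_1-1}{\alpha_1}\cdots\binom{n_s+\alpha_s-1}{\alpha_s},\qquad e_\alpha(\mathcal F)\in\mathbb Z,$$ be its Hilbert polynomial, i.e. the polynomial of this form with $P_{\mathcal F}(n)=H_{\mathcal F}(n)$ whenever all $n_i$ are sufficiently large. Put $\mathcal R(\underline I)=\bigoplus_{n\in\mathbb N^s}\underline I^{n}t^n$, $\mathcal R(\mathcal F)=\bigoplus_{n\in\mathbb N^s}\mathcal F(n)t^n$ and $\mathcal R_{++}=\bigoplus_{n\ge(1,\dots,1)}\underline I^{n}t^n$, an ideal of $\mathcal R(\underline I)$, and let $H^1_{\mathcal R_{++}}(\mathcal R(\mathcal F))$ be the first local cohomology module of the graded $\mathcal R(\underline I)$-module $\mathcal R(\mathcal F)$ with support in $\mathcal R_{++}$, with its $\mathbb Z^s$-grading. Assume that $e_{(d-1)e_i}(\mathcal F)=0$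 for $i=1,\dots,s$. 1. If $d=1$, then $P_{\mathcal F}(n)=H_{\mathcal F}(n)$ for all $n\in\mathbb N^s$. 2. If $d=2$ and $H^1_{\mathcal R_{++}}(\mathcal R(\mathcal F))_n=0$ for all $n\in\mathbb N^s$, then $P_{\mathcal F}(n)=H_{\mathcal F}(n)$ for all $n\in\mathbb N^s$ and $e_{(0,\dots,0)}(\mathcal F)=0$. -/

import Mathlib

open IsLocalRing

noncomputable section

/-! ### Cohen-Macaulay local rings -/

/-- A Noetherian local ring is Cohen-Macaulay if `depth R = dim R`, i.e. if its maximal ideal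
contains an `R`-regular sequence whose length is the Krull dimension of `R`. -/
def IsCohenMacaulayLocal (R : Type*) [CommRing R] [IsLocalRing R] : Prop :=
  ∃ rs : List R, (∀ r ∈ rs, r ∈ maximalIdeal R) ∧
    RingTheory.Sequence.IsRegular R rs ∧ (rs.length : WithBot ℕ∞) = ringKrullDim R

/-! ### Multigraded filtrations -/

section Filtrations

variable {R : Type*} [CommRing R] {s : ℕ}

/-- The ideal `I₁^{n₁} ⋯ Iₛ^{nₛ}` for `n ∈ ℤ^s`, with the convention `Iᵢ^{nᵢ} = R` if `nᵢ ≤ 0`. -/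
def multiPow (I : Fin s → Ideal R) (n : Fin s → ℤ) : Ideal R :=
  ∏ i, I i ^ (n i).toNat

/-- A `ℤ^s`-graded `I = (I₁, …, Iₛ)`-filtration. -/
structure MultiFiltration (I : Fin s → Ideal R) where
  /-- the ideals of the filtration -/
  ideal : (Fin s → ℤ) → Ideal R
  multiPow_le : ∀ n, multiPow I n ≤ ideal n
  mul_le : ∀ n m, ideal n * ideal m ≤ ideal (n + m)
  anti : ∀ m n, n ≤ m → ideal m ≤ ideal n

/-! ### Rees rings and Rees modules

They are realised inside the Laurent polynomial ring `R[t₁^{±1}, …, tₛ^{±1}]`, which is the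
algebra of the additive group `ℤ^s`; the coefficient of `f` at `t^n` is `f.coeff n`. -/

/-- The Laurent polynomial ring `R[t₁^{±1}, …, tₛ^{±1}]`. -/
abbrev LaurentRing (R : Type*) [CommRing R] (s : ℕ) : Type _ := AddMonoidAlgebra R (Fin s → ℤ)

theorem laurent_coeff_mul_mem {f g : LaurentRing R s} {n : Fin s → ℤ} {J : Ideal R}
    (h : ∀ a b, a + b = n → f.coeff a * g.coeff b ∈ J) : (f * g).coeff n ∈ J := by
  classical
  rw [AddMonoidAlgebra.coeff_mul]
  simp only [Finsupp.sum]
  refine Ideal.sum_mem _ fun a _ => Ideal.sum_mem _ fun b _ => ?_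
  split_ifs with hab
  · exact h a b hab
  · exact J.zero_mem

theorem multiPow_mul_le (I : Fin s → Ideal R) (n m : Fin s → ℤ) :
    multiPow I n * multiPow I m ≤ multiPow I (n + m) := by
  unfold multiPow
  rw [← Finset.prod_mul_distrib]
  refine Finset.prod_le_prod' fun i _ => ?_
  rw [← pow_add]
  refine Ideal.pow_le_pow_right ?_
  simp only [Pi.add_apply]
  omega

/-- The subalgebra `⨁ₙ a(n) tⁿ` of the Laurent polynomial ring, for a multiplicative family of
ideals `a`. -/
def familySubalgebra (a : (Fin s → ℤ) → Ideal R) (h0 : a 0 = ⊤)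
    (hmul : ∀ n m, a n * a m ≤ a (n + m)) : Subalgebra R (LaurentRing R s) where
  carrier := {f | ∀ n, f.coeff n ∈ a n}
  mul_mem' := fun {f g} hf hg n => laurent_coeff_mul_mem fun k l hkl =>
    hkl ▸ hmul k l (Ideal.mul_mem_mul (hf k) (hg l))
  add_mem' := fun {f g} hf hg n => by
    simpa using Ideal.add_mem _ (hf n) (hg n)
  algebraMap_mem' := fun r n => by
    classical
    rw [AddMonoidAlgebra.coe_algebraMap]
    simp only [Function.comp_apply, AddMonoidAlgebra.coeff_single, Finsupp.single_apply]
    split_ifs with h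
    · rw [← h, h0]; exact Submodule.mem_top
    · exact (a n).zero_mem

/-- The submodule `⨁ₙ b(n) tⁿ` of the Laurent polynomial ring over `⨁ₙ a(n) tⁿ`. -/
def familySubmodule (a : (Fin s → ℤ) → Ideal R) (h0 : a 0 = ⊤)
    (hmul : ∀ n m, a n * a m ≤ a (n + m)) (b : (Fin s → ℤ) → Ideal R)
    (hb : ∀ n m, a n * b m ≤ b (n + m)) :
    Submodule (familySubalgebra a h0 hmul) (LaurentRing R s) where
  carrier := {f | ∀ n, f.coeff n ∈ b n}
  add_mem' := fun {f g} hf hg n => by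
    simpa using Ideal.add_mem _ (hf n) (hg n)
  zero_mem' := fun n => by simp
  smul_mem' := fun c f hf n => laurent_coeff_mul_mem fun k l hkl =>
    hkl ▸ hb k l (Ideal.mul_mem_mul (c.2 k) (hf l))

/-- Truncation of a `ℤ^s`-indexed family of ideals to the degrees `n ≥ c`. -/
def truncFamily (c : Fin s → ℤ) (a : (Fin s → ℤ) → Ideal R) (n : Fin s → ℤ) : Ideal R :=
  open Classical in if c ≤ n then a n else ⊥

theorem multiPow_zero (I : Fin s → Ideal R) : multiPow I 0 = ⊤ := by
  simp [multiPow, ← Ideal.one_eq_top]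

theorem truncFamily_multiPow_zero (I : Fin s → Ideal R) :
    truncFamily 0 (multiPow I) 0 = ⊤ := by
  simp [truncFamily, multiPow_zero]

theorem truncFamily_mul_le (c d : Fin s → ℤ) (a b : (Fin s → ℤ) → Ideal R)
    (h : ∀ n m, a n * b m ≤ b (n + m)) (hcd : c + d = d) (n m : Fin s → ℤ) :
    truncFamily c a n * truncFamily d b m ≤ truncFamily d b (n + m) := by
  unfold truncFamily
  split_ifs with h1 h2 h3 h3
  · exact h n m
  · exact absurd (hcd ▸ add_le_add h1 h2) h3
  all_goals simp

theorem MultiFiltration.multiPow_mul_ideal_le {I : Fin s → Ideal R} (F : MultiFiltration I)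
    (n m : Fin s → ℤ) : multiPow I n * F.ideal m ≤ F.ideal (n + m) :=
  (Ideal.mul_mono_left (F.multiPow_le n)).trans (F.mul_le n m)

/-- The `ℤ^s`-graded extended Rees ring `R'(I) = ⨁_{n ∈ ℤ^s} Iⁿ tⁿ`. -/
abbrev extReesRing (I : Fin s → Ideal R) : Subalgebra R (LaurentRing R s) :=
  familySubalgebra (multiPow I) (multiPow_zero I) (multiPow_mul_le I)

/-- The `ℤ^s`-graded extended Rees ring `R'(F) = ⨁_{n ∈ ℤ^s} F(n) tⁿ`, as an `R'(I)`-module. -/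
abbrev extReesModule {I : Fin s → Ideal R} (F : MultiFiltration I) :
    Submodule (extReesRing I) (LaurentRing R s) :=
  familySubmodule _ _ _ F.ideal F.multiPow_mul_ideal_le

/-- The `ℕ^s`-graded Rees ring `R(I) = ⨁_{n ≥ 0} Iⁿ tⁿ`. -/
abbrev reesRing (I : Fin s → Ideal R) : Subalgebra R (LaurentRing R s) :=
  familySubalgebra (truncFamily 0 (multiPow I)) (truncFamily_multiPow_zero I)
    (truncFamily_mul_le 0 0 _ _ (multiPow_mul_le I) (zero_add 0))

/-- The `ℕ^s`-graded Rees ring `R(F) = ⨁_{n ≥ 0} F(n) tⁿ`, as an `R(I)`-module. -/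
abbrev reesModule {I : Fin s → Ideal R} (F : MultiFiltration I) :
    Submodule (reesRing I) (LaurentRing R s) :=
  familySubmodule _ _ _ (truncFamily 0 F.ideal)
    (truncFamily_mul_le 0 0 _ _ F.multiPow_mul_ideal_le (zero_add 0))

/-- The ideal `R(I)₊₊ = ⨁_{n ≥ (1,…,1)} Iⁿ tⁿ` of `R(I)`. -/
def reesIrrelevant (I : Fin s → Ideal R) : Ideal (reesRing I) :=
  (familySubmodule _ (truncFamily_multiPow_zero I)
    (truncFamily_mul_le 0 0 _ _ (multiPow_mul_le I) (zero_add 0)) (truncFamily 1 (multiPow I))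
    (truncFamily_mul_le 0 1 _ _ (multiPow_mul_le I) (zero_add 1))).comap
    (Algebra.linearMap (reesRing I) (LaurentRing R s))

/-- A Laurent polynomial is homogeneous of degree `n` if only `tⁿ` occurs in it. -/
def IsLaurentHomogeneous (n : Fin s → ℤ) (f : LaurentRing R s) : Prop :=
  ∀ k, k ≠ n → f.coeff k = 0

/-- The component `R(F)ₙ` of degree `n` of the graded module `R(F)`. -/
def reesComponent {I : Fin s → Ideal R} (F : MultiFiltration I) (n : Fin s → ℤ) :
    AddSubgroup (reesModule F) where
  carrier := {f | IsLaurentHomogeneous n (f : LaurentRing R s)}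
  add_mem' := fun {f g} hf hg k hk => by simp [hf k hk, hg k hk]
  zero_mem' := fun k _ => by simp
  neg_mem' := fun {f} hf k hk => by simp [hf k hk]

/-- An `I`-filtration `F` is `I`-admissible if `F(n) = F(n⁺)` for all `n` and `R'(F)` is a finite
`R'(I)`-module. -/
def MultiFiltration.IsAdmissible {I : Fin s → Ideal R} (F : MultiFiltration I) : Prop :=
  (∀ n, F.ideal n = F.ideal (n ⊔ 0)) ∧ Module.Finite (extReesRing I) (extReesModule F)

/-! ### Hilbert function, Hilbert polynomial, Hilbert coefficients -/

/-- The Hilbert function `H_F(n) = λ(R / F(n))`. (If the ideals `Iᵢ` are primary to the maximal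
ideal, these lengths are finite, because `Iⁿ ⊆ F(n)`.) -/
def MultiFiltration.hilbertFunction {I : Fin s → Ideal R} (F : MultiFiltration I)
    (n : Fin s → ℤ) : ℤ :=
  (Module.length R (R ⧸ F.ideal n)).toNat

/-- The value at `n ∈ ℤ^s` of the numerical polynomial
`∑_{|α| ≤ d} (-1)^{d-|α|} e_α ∏ᵢ binom(nᵢ + αᵢ - 1, αᵢ)`. -/
def numericalPoly (d : ℕ) (e : (Fin s → ℕ) → ℤ) (n : Fin s → ℤ) : ℤ :=
  ∑ α ∈ (Finset.Iic (fun _ : Fin s => d)).filter (fun α => ∑ i, α i ≤ d),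
    (-1) ^ (d - ∑ i, α i) * e α * ∏ i, Ring.choose (n i + α i - 1) (α i)

/-- The integers `e_α`, `|α| ≤ d`, are Hilbert coefficients of `F` in dimension `d`: the numerical
polynomial that they define agrees with `H_F(n)` for all large `n`. -/
def MultiFiltration.IsHilbertCoeff {I : Fin s → Ideal R} (F : MultiFiltration I) (d : ℕ)
    (e : (Fin s → ℕ) → ℤ) : Prop :=
  ∃ N : Fin s → ℤ, ∀ n, N ≤ n → numericalPoly d e n = F.hilbertFunction n

/-- The Hilbert coefficients `e_α(F)`, `|α| ≤ d`, of a filtration in a ring of dimension `d`. They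
are determined by the condition above; where no such integers exist (never for an admissible
filtration in a Noetherian local ring of dimension `d`) the value is the meaningless `0`. -/
def MultiFiltration.hilbertCoeff {I : Fin s → Ideal R} (F : MultiFiltration I) (d : ℕ) :
    (Fin s → ℕ) → ℤ :=
  open Classical in if h : ∃ e, F.IsHilbertCoeff d e then h.choose else 0

/-- The Hilbert polynomial `P_F(n)` of a filtration in a ring of dimension `d`. -/
def MultiFiltration.hilbertPoly {I : Fin s → Ideal R} (F : MultiFiltration I) (d : ℕ)
    (n : Fin s → ℤ) : ℤ :=
  numericalPoly d (F.hilbertCoeff d) n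

end Filtrations

/-! ### First local cohomology through the Čech complex -/

section Cech

variable {S : Type*} [CommRing S] (M : Type*) [AddCommGroup M] [Module S M]

theorem isUnit_algebraMap_away_of_dvd {a c : S} (h : a ∣ c) (y : Submonoid.powers a) :
    IsUnit (algebraMap S (Module.End S (LocalizedModule (Submonoid.powers c) M)) y) := by
  obtain ⟨b, rfl⟩ := h
  obtain ⟨_, k, rfl⟩ := y
  have hu := IsLocalizedModule.map_units
    (LocalizedModule.mkLinearMap (Submonoid.powers (a * b)) M)
    ⟨a * b, Submonoid.mem_powers _⟩
  simp only [map_mul] at hu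
  have hc : Commute (algebraMap S (Module.End S (LocalizedModule (Submonoid.powers (a * b)) M)) a)
      (algebraMap S _ b) := Algebra.commutes a _
  simpa using ((hc.isUnit_mul_iff.mp hu).1).pow k

/-- The canonical map `M_a → M_c` between localizations at powers of elements `a ∣ c`. -/
def awayMap {a c : S} (h : a ∣ c) :
    LocalizedModule (Submonoid.powers a) M →ₗ[S] LocalizedModule (Submonoid.powers c) M :=
  LocalizedModule.lift (Submonoid.powers a) (LocalizedModule.mkLinearMap (Submonoid.powers c) M)
    (isUnit_algebraMap_away_of_dvd M h)

variable {m : ℕ} (x : Fin m → S)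

/-- The differential `M → ∏ᵢ M_{xᵢ}` of the Čech complex of `M` on `x₁, …, xₘ`. -/
def cechD0 : M →ₗ[S] (∀ i, LocalizedModule (Submonoid.powers (x i)) M) :=
  LinearMap.pi fun i => LocalizedModule.mkLinearMap (Submonoid.powers (x i)) M

/-- The differential `∏ᵢ M_{xᵢ} → ∏_{i<j} M_{xᵢxⱼ}`, `(cᵢ) ↦ (cⱼ - cᵢ)`, of the Čech complex. -/
def cechD1 : (∀ i, LocalizedModule (Submonoid.powers (x i)) M) →ₗ[S]
    (∀ p : {p : Fin m × Fin m // p.1 < p.2},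
      LocalizedModule (Submonoid.powers (x p.1.1 * x p.1.2)) M) :=
  LinearMap.pi fun p =>
    (awayMap M (Dvd.intro_left (x p.1.1) rfl)).comp (LinearMap.proj p.1.2) -
      (awayMap M (Dvd.intro (x p.1.2) rfl)).comp (LinearMap.proj p.1.1)

/-- The first local cohomology module `H¹_{(x₁, …, xₘ)}(M)` of a module over a Noetherian ring: the
first cohomology of the Čech complex `M → ∏ᵢ M_{xᵢ} → ∏_{i<j} M_{xᵢxⱼ} → ⋯`. -/
abbrev CechH1 : Type _ :=
  LinearMap.ker (cechD1 M x) ⧸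
    (LinearMap.range (cechD0 M x)).submoduleOf (LinearMap.ker (cechD1 M x))

variable {M} {G : Type*} [AddCommGroup G] (comp : G → AddSubgroup M) (δ : Fin m → G)

/-- `z ∈ M_a` is homogeneous of degree `n`, where `a` has degree `g` and `comp` is the grading of
`M`: it is of the form `u / a^k` with `u` of degree `n + k g`. -/
def IsAwayHomogeneous (a : S) (g n : G) (z : LocalizedModule (Submonoid.powers a) M) : Prop :=
  ∃ (k : ℕ) (u : M), u ∈ comp (n + k • g) ∧
    z = LocalizedModule.mk u ⟨a ^ k, Submonoid.pow_mem _ (Submonoid.mem_powers a) k⟩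

/-- The component of degree `n` of `H¹_{(x₁, …, xₘ)}(M)`, where `M` is graded by `comp` and `xᵢ` is
homogeneous of degree `δᵢ`: the classes of the cocycles of degree `n`. -/
def cechH1Component (n : G) : AddSubgroup (CechH1 M x) :=
  AddSubgroup.closure {h | ∃ c : LinearMap.ker (cechD1 M x),
    (∀ i, IsAwayHomogeneous comp (x i) (δ i) n (c.1 i)) ∧ h = Submodule.Quotient.mk c}

end Cech

end

/-! Write G = H - P for the difference between the Hilbert function and the Hilbert polynomial. It
vanishes far out, and the proof is a monotonicity argument: differences of H are bounded everywhere
by the constant that they attain for large degrees, which is the corresponding difference of P.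

For d = 1, a general a in I_i is a nonzerodivisor with a F(n) ⊆ F(n + e_i), and equality holds once
n_i is large (`exists_principal_reduction`). Since λ(R/aJ) = λ(R/a) + λ(R/J), the difference H(n +
e_i) - H(n) is at most λ(R/a), with equality for n_i large. Hence G does not increase along ℕ^s. It
starts at G(0) = e_0 = 0 and ends at 0, so it is zero.

For d = 2, choose a in I_i and c in I_j forming a regular sequence with a F(n + e_j) + c F(n + e_i)
⊆ F(n + e_i + e_j), an equality for n_i, n_j large (`exists_joint_reduction`). A four-term exact
sequence (`length_quotient_span_mul_sup_span_mul`) bounds the second difference of H at n by λ(R/(a,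
c)), provided (F(n + e_i) : a) ∩ (F(n + e_j) : c) = F(n). This holds when F(n) is Ratliff-Rush
closed, and vanishing of H¹ in degree n gives that closedness for n ≥ 0
(`MultiFiltration.mem_of_cechH1Component_eq_bot`). So each first difference of G is antitone on ℕ^s
and eventually 0. Its value at 0 is at most its value at -e_i, which is ±e_{e_i} = 0. Thus G is
constant on ℕ^s, hence 0, and P(0) = H(0) = 0 reads e_0 = 0.

The reductions come from superficial elements (`exists_superficial`), found by prime avoidance over
the extended Rees ring; the case d = 2 passes to R/a and uses the one-dimensional statement there.
-/

noncomputable section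

/-! ### Noetherianity of the extended Rees ring and finitely generated families of ideals -/

section FiniteFamilies

variable {R : Type*} [CommRing R] {s : ℕ}

theorem single_coeff_mem {b : (Fin s → ℤ) → Ideal R} {n : Fin s → ℤ} {c : R} (hc : c ∈ b n)
    (m : Fin s → ℤ) : (AddMonoidAlgebra.single n c : LaurentRing R s).coeff m ∈ b m := by
  classical
  rw [AddMonoidAlgebra.coeff_single, Finsupp.single_apply]
  split_ifs with h
  · exact h ▸ hc
  · exact zero_mem _

/-- The homogeneous element `c tⁿ` of the extended Rees ring. -/
def extReesSingle (I : Fin s → Ideal R) (n : Fin s → ℤ) (c : R) (hc : c ∈ multiPow I n) :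
    extReesRing I :=
  ⟨AddMonoidAlgebra.single n c, single_coeff_mem hc⟩

theorem multiPow_of_nonpos (I : Fin s → Ideal R) {n : Fin s → ℤ} (hn : n ≤ 0) :
    multiPow I n = ⊤ := by
  unfold multiPow
  rw [← Ideal.one_eq_top]
  refine Finset.prod_eq_one fun i _ => ?_
  have := hn i
  simp only [Pi.zero_apply] at this
  rw [Int.toNat_of_nonpos this, pow_zero]

theorem multiPow_single (I : Fin s → Ideal R) (i : Fin s) (k : ℕ) :
    multiPow I (Pi.single i (k : ℤ)) = I i ^ k := by
  unfold multiPow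
  rw [Finset.prod_eq_single i]
  · simp
  · intro j _ hj
    simp [hj]
  · simp

theorem multiPow_single_one (I : Fin s → Ideal R) (i : Fin s) :
    multiPow I (Pi.single i 1) = I i := by
  simpa using multiPow_single I i 1

/-- This minimality of the family Iⁿ is what shows that the extended Rees ring is generated by the
I_i t_i and the t_i⁻¹: it is applied to the graded pieces of the subalgebra that they generate. -/
theorem multiPow_le_of_multiplicative (I : Fin s → Ideal R) (a : (Fin s → ℤ) → Ideal R)
    (h0 : a 0 = ⊤) (hmul : ∀ n m, a n * a m ≤ a (n + m)) (hI : ∀ i, I i ≤ a (Pi.single i 1))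
    (hneg : ∀ i, a (Pi.single i (-1)) = ⊤) (n : Fin s → ℤ) : multiPow I n ≤ a n := by
  classical
  have hpos : ∀ i (k : ℕ), I i ^ k ≤ a (Pi.single i (k : ℤ)) := by
    intro i k
    induction k with
    | zero => simp [h0]
    | succ k ih =>
      rw [pow_succ]
      refine (Ideal.mul_mono ih (hI i)).trans ((hmul _ _).trans_eq ?_)
      rw [← Pi.single_add]
      push_cast
      rfl
  have hn : ∀ i (k : ℕ), a (Pi.single i (-(k : ℤ))) = ⊤ := by
    intro i k
    induction k with
    | zero => simp [h0]
    | succ k ih =>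
      have := hmul (Pi.single i (-(k : ℤ))) (Pi.single i (-1))
      rw [ih, hneg, ← Pi.single_add] at this
      rw [eq_top_iff]
      convert this using 1
      · simp
      · push_cast
        congr 2
        ring
  have hz : ∀ i (z : ℤ), I i ^ z.toNat ≤ a (Pi.single i z) := by
    intro i z
    rcases le_total 0 z with h | h
    · have := hpos i z.toNat
      rwa [Int.toNat_of_nonneg h] at this
    · have := hn i (-z).toNat
      rw [Int.toNat_of_nonneg (by omega), neg_neg] at this
      rw [this]
      exact le_top
  have hS : ∀ S : Finset (Fin s),
      ∏ i ∈ S, I i ^ (n i).toNat ≤ a (∑ i ∈ S, Pi.single i (n i)) := by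
    intro S
    induction S using Finset.induction_on with
    | empty => simp [h0]
    | insert i S hi ih =>
      rw [Finset.prod_insert hi, Finset.sum_insert hi]
      exact (Ideal.mul_mono (hz i _) ih).trans (hmul _ _)
  have := hS Finset.univ
  rwa [Finset.univ_sum_single] at this

/-- By Hilbert's basis theorem, since finitely many elements t_i⁻¹ and g t_i, with g running over
generators of I_i, generate the ring over R. -/
theorem extReesRing_isNoetherianRing [IsNoetherianRing R] (I : Fin s → Ideal R) :
    IsNoetherianRing (extReesRing I) := by
  classical
  choose g hg using fun i => (isNoetherianRing_iff_ideal_fg R).mp ‹_› (I i)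
  set T : Finset (LaurentRing R s) :=
    (Finset.univ.image fun i => AddMonoidAlgebra.single (Pi.single i (-1)) 1) ∪
      (Finset.univ.biUnion fun i => (g i).image (AddMonoidAlgebra.single (Pi.single i 1)))
    with hT
  have hfg : (extReesRing I).FG := by
    refine ⟨T, le_antisymm ?_ ?_⟩
    · rw [Algebra.adjoin_le_iff]
      intro f hf
      simp only [hT, Finset.coe_union, Finset.coe_image, Finset.coe_univ, Set.image_univ,
        Finset.coe_biUnion, Set.mem_union, Set.mem_range, Set.mem_iUnion, Set.mem_image] at hf
      rcases hf with ⟨i, rfl⟩ | ⟨i, _, c, hc, rfl⟩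
      · refine single_coeff_mem ?_
        rw [multiPow_of_nonpos]
        · trivial
        · rw [Pi.single_nonpos]
          norm_num
      · refine single_coeff_mem ?_
        rw [multiPow_single_one, ← hg i]
        exact Ideal.subset_span hc
    · set A := Algebra.adjoin R (T : Set (LaurentRing R s)) with hA
      let a : (Fin s → ℤ) → Ideal R := fun n =>
        (Subalgebra.toSubmodule A).comap
          ({ toFun := AddMonoidAlgebra.single n
             map_add' := AddMonoidAlgebra.single_add n
             map_smul' := fun r x => (AddMonoidAlgebra.smul_single r n x).symm } :
            R →ₗ[R] LaurentRing R s)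
      have ha : ∀ n c, c ∈ a n ↔ (AddMonoidAlgebra.single n c : LaurentRing R s) ∈ A :=
        fun n c => Iff.rfl
      have hle := multiPow_le_of_multiplicative I a
        (by
          rw [Ideal.eq_top_iff_one, ha]
          exact A.one_mem)
        (by
          intro n m
          rw [Ideal.mul_le]
          intro x hx y hy
          rw [ha] at *
          rw [← AddMonoidAlgebra.single_mul_single]
          exact A.mul_mem hx hy)
        (by
          intro i
          rw [← hg i]
          refine Ideal.span_le.mpr fun c hc => ?_
          rw [SetLike.mem_coe, ha]
          refine Algebra.subset_adjoin ?_
          simp only [hT, Finset.coe_union, Finset.coe_biUnion, Set.mem_union, Set.mem_iUnion]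
          exact Or.inr ⟨i, by simp, by
            rw [Finset.coe_image]
            exact ⟨c, hc, rfl⟩⟩)
        (by
          intro i
          rw [Ideal.eq_top_iff_one, ha]
          refine Algebra.subset_adjoin ?_
          simp [hT])
      intro f hf
      rw [← AddMonoidAlgebra.sum_coeff_single f]
      exact A.sum_mem fun n _ => (ha n _).mp (hle n (hf n))
  have : Algebra.FiniteType R (extReesRing I) := (extReesRing I).fg_iff_finiteType.mp hfg
  exact Algebra.FiniteType.isNoetherianRing R _

/-- A family of ideals `b`, with `Iⁿ b(m) ⊆ b(n + m)`, is finite over `I` if finitely many of its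
members generate the others, i.e. if `⨁ b(n) tⁿ` is finite over the extended Rees ring of `I`. -/
def IsFiniteFamily (I : Fin s → Ideal R) (b : (Fin s → ℤ) → Ideal R) : Prop :=
  ∃ D : Finset (Fin s → ℤ), ∀ n, b n ≤ ⨆ p ∈ D, multiPow I (n - p) * b p

/-- The module `⨁ b(n) tⁿ` over the extended Rees ring. -/
abbrev familyModule (I : Fin s → Ideal R) (b : (Fin s → ℤ) → Ideal R)
    (hb : ∀ n m, multiPow I n * b m ≤ b (n + m)) :
    Submodule (extReesRing I) (LaurentRing R s) :=
  familySubmodule _ (multiPow_zero I) (multiPow_mul_le I) b hb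

theorem isFiniteFamily_of_fg {I : Fin s → Ideal R} {b : (Fin s → ℤ) → Ideal R}
    (hb : ∀ n m, multiPow I n * b m ≤ b (n + m))
    (h : (familyModule I b hb).FG) : IsFiniteFamily I b := by
  classical
  obtain ⟨T, hT⟩ := h
  -- The degrees occurring in the generators suffice: the family `c` generated from these degrees is
  -- again a module, and it contains every generator.
  let D : Finset (Fin s → ℤ) := T.biUnion fun f => f.coeff.support
  let c : (Fin s → ℤ) → Ideal R := fun n => ⨆ p ∈ D, multiPow I (n - p) * b p
  have hc : ∀ n m, multiPow I n * c m ≤ c (n + m) := by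
    intro n m
    simp only [c, Ideal.mul_iSup]
    refine iSup₂_mono fun p _ => ?_
    rw [← mul_assoc, add_sub_assoc]
    exact Ideal.mul_mono_left (multiPow_mul_le I n _)
  have hle : familyModule I b hb ≤ familyModule I c hc := by
    rw [← hT, Submodule.span_le]
    intro f hf n
    by_cases hn : f.coeff n = 0
    · rw [hn]
      exact zero_mem _
    · have hnD : n ∈ D := Finset.mem_biUnion.mpr ⟨f, hf, Finsupp.mem_support_iff.mpr hn⟩
      refine Submodule.mem_iSup_of_mem n (Submodule.mem_iSup_of_mem hnD ?_)
      rw [sub_self, multiPow_zero, Ideal.top_mul]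
      exact (hT ▸ Submodule.subset_span hf : f ∈ familyModule I b hb) n
  refine ⟨D, fun n x hx => ?_⟩
  have := hle (x := AddMonoidAlgebra.single n x) (single_coeff_mem hx) n
  rwa [AddMonoidAlgebra.coeff_single, Finsupp.single_eq_same] at this

theorem familyModule_fg [IsNoetherianRing R] {I : Fin s → Ideal R} {b : (Fin s → ℤ) → Ideal R}
    (hb : ∀ n m, multiPow I n * b m ≤ b (n + m)) (h : IsFiniteFamily I b) :
    (familyModule I b hb).FG := by
  classical
  obtain ⟨D, hD⟩ := h
  choose g hg using fun p => (isNoetherianRing_iff_ideal_fg R).mp ‹_› (b p)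
  set T : Finset (LaurentRing R s) := D.biUnion fun p => (g p).image (AddMonoidAlgebra.single p)
    with hT
  refine ⟨T, le_antisymm ?_ ?_⟩
  · rw [Submodule.span_le]
    intro f hf
    simp only [hT, Finset.coe_biUnion, Set.mem_iUnion, Finset.coe_image] at hf
    obtain ⟨p, _, x, hx, rfl⟩ := hf
    refine single_coeff_mem ?_
    rw [← hg p]
    exact Ideal.subset_span hx
  · set N := Submodule.span (extReesRing I) (T : Set (LaurentRing R s)) with hN
    let K : (Fin s → ℤ) → Ideal R := fun n =>
      (N.restrictScalars R).comap
        ({ toFun := AddMonoidAlgebra.single n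
           map_add' := AddMonoidAlgebra.single_add n
           map_smul' := fun r x => (AddMonoidAlgebra.smul_single r n x).symm } :
          R →ₗ[R] LaurentRing R s)
    have hK : ∀ n c, c ∈ K n ↔ (AddMonoidAlgebra.single n c : LaurentRing R s) ∈ N :=
      fun n c => Iff.rfl
    have hbK : ∀ p ∈ D, b p ≤ K p := by
      intro p hp
      rw [← hg p]
      refine Ideal.span_le.mpr fun x hx => ?_
      rw [SetLike.mem_coe, hK]
      refine Submodule.subset_span ?_
      simp only [hT, Finset.coe_biUnion, Set.mem_iUnion, Finset.coe_image]
      exact ⟨p, hp, x, hx, rfl⟩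
    have hle : ∀ n, b n ≤ K n := by
      intro n
      refine (hD n).trans (iSup₂_le fun p hp => ?_)
      rw [Ideal.mul_le]
      intro x hx y hy
      rw [hK]
      have := N.smul_mem (extReesSingle I (n - p) x hx) ((hK p y).mp (hbK p hp hy))
      rw [Subalgebra.smul_def, smul_eq_mul] at this
      change AddMonoidAlgebra.single (n - p) x * _ ∈ N at this
      rwa [AddMonoidAlgebra.single_mul_single, sub_add_cancel] at this
    intro f hf
    rw [← AddMonoidAlgebra.sum_coeff_single f]
    exact N.sum_mem fun n _ => (hK n _).mp (hle n (hf n))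

theorem familyModule_isNoetherian [IsNoetherianRing R] {I : Fin s → Ideal R}
    {b : (Fin s → ℤ) → Ideal R} (hb : ∀ n m, multiPow I n * b m ≤ b (n + m))
    (h : IsFiniteFamily I b) : IsNoetherian (extReesRing I) (familyModule I b hb) := by
  have := extReesRing_isNoetherianRing I
  exact isNoetherian_of_fg_of_noetherian _ (familyModule_fg hb h)

/-- Submodules of a Noetherian module are finitely generated. -/
theorem IsFiniteFamily.mono [IsNoetherianRing R] {I : Fin s → Ideal R}
    {b c : (Fin s → ℤ) → Ideal R} (hb : ∀ n m, multiPow I n * b m ≤ b (n + m))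
    (hc : ∀ n m, multiPow I n * c m ≤ c (n + m)) (h : IsFiniteFamily I c) (hbc : ∀ n, b n ≤ c n) :
    IsFiniteFamily I b := by
  have hle : familyModule I b hb ≤ familyModule I c hc := fun f hf n => hbc n (hf n)
  exact isFiniteFamily_of_fg hb
    (isNoetherian_submodule.mp (familyModule_isNoetherian hc h) _ hle)

theorem IsFiniteFamily.shift {I : Fin s → Ideal R} {b : (Fin s → ℤ) → Ideal R}
    (h : IsFiniteFamily I b) (q : Fin s → ℤ) : IsFiniteFamily I fun n => b (n + q) := by
  classical
  obtain ⟨D, hD⟩ := h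
  refine ⟨D.image fun p => p - q, fun n => (hD _).trans (iSup₂_le fun p hp => ?_)⟩
  have hp' : p - q ∈ D.image fun p => p - q := Finset.mem_image_of_mem _ hp
  refine le_iSup₂_of_le (f := fun r (_ : r ∈ D.image fun p => p - q) =>
    multiPow I (n - r) * b (r + q)) (p - q) hp' (le_of_eq ?_)
  rw [sub_add_cancel, show n - (p - q) = n + q - p by abel]

/-- The degreewise form of finiteness passes to images without comparing the two Rees rings, because
extension of ideals commutes with sums and products. It serves for the passage to R/a. -/
theorem IsFiniteFamily.map {R' : Type*} [CommRing R'] {I : Fin s → Ideal R}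
    {b : (Fin s → ℤ) → Ideal R} (h : IsFiniteFamily I b) (φ : R →+* R') :
    IsFiniteFamily (fun i => (I i).map φ) fun n => (b n).map φ := by
  obtain ⟨D, hD⟩ := h
  refine ⟨D, fun n => (Ideal.map_mono (hD n)).trans ?_⟩
  simp only [Ideal.map_iSup, Ideal.map_mul, multiPow]
  refine iSup₂_mono fun p _ => le_of_eq ?_
  congr 1
  simp only [← Ideal.mapHom_apply, map_prod, map_pow]

theorem multiPow_map {R' : Type*} [CommRing R'] (I : Fin s → Ideal R) (φ : R →+* R')
    (n : Fin s → ℤ) : multiPow (fun i => (I i).map φ) n = (multiPow I n).map φ := by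
  simp only [multiPow, ← Ideal.mapHom_apply, map_prod, map_pow]

/-- In large degree `nᵢ`, the members of a finite family are generated by those in degree `n - k eᵢ`
through `Iᵢᵏ`. -/
theorem IsFiniteFamily.exists_le_pow_mul {I : Fin s → Ideal R} {b : (Fin s → ℤ) → Ideal R}
    (hb : ∀ n m, multiPow I n * b m ≤ b (n + m)) (h : IsFiniteFamily I b) (i : Fin s) (k : ℕ) :
    ∃ p₀ : ℤ, ∀ n : Fin s → ℤ, p₀ ≤ n i → b n ≤ I i ^ k * b (n - Pi.single i (k : ℤ)) := by
  classical
  obtain ⟨D, hD⟩ := h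
  obtain ⟨B, hB⟩ := (D.image fun p => p i).bddAbove
  -- With B bounding the i-th coordinates of the generating degrees p, the condition n_i ≥ B + k
  -- gives n_i - p_i ≥ k, so a factor I_iᵏ splits off from every I^{n-p}.
  refine ⟨B + k, fun n hn => (hD n).trans (iSup₂_le fun p hp => ?_)⟩
  have hp : p i ≤ B := hB (by simpa using ⟨p, hp, rfl⟩)
  have h1 : multiPow I (n - p) = I i ^ k * multiPow I (n - p - Pi.single i (k : ℤ)) := by
    unfold multiPow
    rw [← Finset.mul_prod_erase _ _ (Finset.mem_univ i),
      ← Finset.mul_prod_erase (a := i) _ _ (Finset.mem_univ i), ← mul_assoc, ← pow_add]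
    congr 1
    · congr 1
      simp only [Pi.sub_apply, Pi.single_eq_same]
      omega
    · refine Finset.prod_congr rfl fun j hj => ?_
      simp [Finset.ne_of_mem_erase hj]
  rw [h1, mul_assoc]
  refine Ideal.mul_mono_right ((hb _ _).trans_eq ?_)
  congr 1
  abel

end FiniteFamilies

/-! ### Prime avoidance over an infinite residue field, and associated primes -/

section Avoidance

/-- A module over a local ring with infinite residue field is not a finite union of proper
submodules. -/
theorem Submodule.exists_forall_notMem_of_infinite_residueField {R V : Type*} [CommRing R]
    [IsLocalRing R] [Infinite (ResidueField R)] [AddCommGroup V] [Module R V]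
    {W : Set (Submodule R V)} (hW : W.Finite) (htop : ⊤ ∉ W) : ∃ v, ∀ p ∈ W, v ∉ p := by
  by_contra! h
  obtain ⟨p, hp, hfi⟩ := Submodule.exists_finiteIndex_of_cover (p := id) (s := hW.toFinset) (by
    rw [Set.eq_univ_iff_forall]
    intro v
    obtain ⟨p, hp, hv⟩ := h v
    exact Set.mem_biUnion (hW.mem_toFinset.mpr hp) hv)
  have hfi : p.toAddSubgroup.FiniteIndex := hfi
  have hpW : p ∈ W := hW.mem_toFinset.mp hp
  have : Finite (V ⧸ p) := AddSubgroup.finite_quotient_of_finiteIndex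
  have : Nontrivial (V ⧸ p) :=
    Submodule.Quotient.nontrivial_iff.mpr (ne_of_mem_of_not_mem hpW htop)
  obtain ⟨y, hy⟩ := exists_ne (0 : V ⧸ p)
  -- One of the covering submodules has finite index. Lifts of distinct residues differ by a unit,
  -- so their multiples of a nonzero y are distinct, and the finite quotient would contain
  -- infinitely many elements.
  let σ : ResidueField R → R := Function.surjInv (residue_surjective (R := R))
  have hσ : Function.Injective fun t => σ t • y := by
    intro t u htu
    by_contra hne
    have hunit : IsUnit (σ t - σ u) := by
      by_contra hnu
      have := (residue_eq_zero_iff _).mpr ((mem_maximalIdeal _).mpr hnu)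
      rw [map_sub, Function.surjInv_eq residue_surjective, Function.surjInv_eq residue_surjective,
          sub_eq_zero] at this
      exact hne this
    have h0 : (σ t - σ u) • y = 0 := by
      rw [sub_smul, sub_eq_zero]
      exact htu
    exact hy ((hunit.smul_eq_zero).mp h0)
  exact (Infinite.of_injective _ hσ).not_finite inferInstance

variable {A Q : Type*} [CommRing A] [IsNoetherianRing A] [AddCommGroup Q] [Module A Q]

/-- Every associated prime of Q is already one of ker τ. If P is the annihilator of y and τᵏy is the
last nonzero power multiple, then τᵏ lies outside the prime P, so τᵏy has annihilator P too; and it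
lies in ker τ. -/
theorem associatedPrimes_finite_of_locally_nilpotent (τ : A) (hτ : ∀ y : Q, ∃ k, τ ^ k • y = 0)
    (hker : (LinearMap.ker (LinearMap.lsmul A Q τ)).FG) : (associatedPrimes A Q).Finite := by
  have : Module.Finite A (LinearMap.ker (LinearMap.lsmul A Q τ)) := Module.Finite.iff_fg.mpr hker
  refine (associatedPrimes.finite A (LinearMap.ker (LinearMap.lsmul A Q τ))).subset fun P hP => ?_
  rw [AssociatedPrimes.mem_iff, isAssociatedPrime_iff] at hP ⊢
  obtain ⟨hprime, y, hy⟩ := hP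
  classical
  have hmem : ∀ r, r ∈ P ↔ r • y = 0 := by
    intro r
    rw [hy, Submodule.mem_colon_singleton, Submodule.mem_bot]
  have hk0 : Nat.find (hτ y) ≠ 0 := by
    intro h0
    have := Nat.find_spec (hτ y)
    rw [h0, pow_zero] at this
    exact hprime.ne_top ((Ideal.eq_top_iff_one _).mpr ((hmem 1).mpr this))
  obtain ⟨k, hk⟩ := Nat.exists_eq_succ_of_ne_zero hk0
  have hk1 : τ ^ (k + 1) • y = 0 := by
    have := Nat.find_spec (hτ y)
    rwa [hk] at this
  have hk2 : τ ^ k • y ≠ 0 := Nat.find_min (hτ y) (by omega)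
  refine ⟨hprime, ⟨τ ^ k • y, ?_⟩, ?_⟩
  · rw [LinearMap.mem_ker, LinearMap.lsmul_apply, smul_smul, ← pow_succ']
    exact hk1
  · ext r
    rw [Submodule.mem_colon_singleton, Submodule.mem_bot, ← Subtype.coe_inj, Submodule.coe_smul,
      Submodule.coe_zero, smul_smul, ← hmem]
    constructor
    · exact fun h => P.mul_mem_right _ h
    · exact fun h => (hprime.mem_or_mem h).resolve_right fun h' => hk2 ((hmem _).mp h')

/-- The minimal primes over the annihilator of Y are associated to Y, hence to Q, and contain α. By
assumption they contain 𝔞, so 𝔞 lies in the radical of the annihilator. -/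
theorem exists_pow_le_annihilator_of_associatedPrimes {Y : Submodule A Q} (hY : Y.FG) {α : A}
    {𝔞 : Ideal A} (hα : α ∈ Y.annihilator) (h : ∀ P ∈ associatedPrimes A Q, α ∈ P → 𝔞 ≤ P) :
    ∃ K, 𝔞 ^ K ≤ Y.annihilator := by
  have : Module.Finite A Y := Module.Finite.iff_fg.mpr hY
  refine Ideal.exists_pow_le_of_le_radical_of_fg ?_ (IsNoetherian.noetherian _)
  rw [← Ideal.sInf_minimalPrimes, le_sInf_iff]
  intro P hP
  have hass := Module.associatedPrimes.minimalPrimes_annihilator_subset_associatedPrimes A Y hP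
  exact h P (associatedPrimes.subset_of_injective Y.injective_subtype hass) (hP.1.2 hα)

end Avoidance

/-! ### Existence of superficial elements -/

section Superficial

variable {R : Type*} [CommRing R] {s : ℕ}

theorem coeff_single_mul (g : Fin s → ℤ) (r : R) (f : LaurentRing R s) (n : Fin s → ℤ) :
    (AddMonoidAlgebra.single g r * f).coeff n = r * f.coeff (n - g) := by
  rw [AddMonoidAlgebra.coeff_single_mul_apply, neg_add_eq_sub]

theorem mul_single_mem_familySubmodule {b : (Fin s → ℤ) → Ideal R} {g : Fin s → ℤ} {r : R}
    {f : LaurentRing R s} (h : ∀ n, r * f.coeff n ∈ b (n + g)) (n : Fin s → ℤ) :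
    (AddMonoidAlgebra.single g r * f).coeff n ∈ b n := by
  have := h (n - g)
  rwa [coeff_single_mul, ← sub_add_cancel n g, add_sub_cancel_right]

/-- The `R`-linear map `Iᵢ → R'(I)`, `c ↦ c tᵢ`. -/
def extReesDegreeOne (I : Fin s → Ideal R) (i : Fin s) : I i →ₗ[R] extReesRing I where
  toFun c := extReesSingle I (Pi.single i 1) c (by rw [multiPow_single_one]; exact c.2)
  map_add' c d := Subtype.ext (AddMonoidAlgebra.single_add _ _ _)
  map_smul' r c := Subtype.ext (AddMonoidAlgebra.smul_single r _ _).symm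

theorem exists_mem_pow_span_range (I : Fin s → Ideal R) (i : Fin s) (k : ℕ) (u : R)
    (hu : u ∈ I i ^ k) : ∃ w ∈ Ideal.span (Set.range (extReesDegreeOne I i)) ^ k,
      (w : LaurentRing R s) = AddMonoidAlgebra.single (Pi.single i (k : ℤ)) u := by
  induction k generalizing u with
  | zero =>
    refine ⟨algebraMap R _ u, by simp, ?_⟩
    simp
  | succ k ih =>
    rw [pow_succ] at hu
    induction hu using Submodule.mul_induction_on' with
    | mem_mul_mem x hx y hy =>
      obtain ⟨w, hw, hwx⟩ := ih x hx
      refine ⟨w * extReesDegreeOne I i ⟨y, hy⟩, ?_, ?_⟩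
      · rw [pow_succ]
        exact Ideal.mul_mem_mul hw (Ideal.subset_span ⟨_, rfl⟩)
      · rw [Subalgebra.coe_mul, hwx]
        refine (AddMonoidAlgebra.single_mul_single _ _ _ _).trans ?_
        rw [← Pi.single_add]
        push_cast
        rfl
    | add x _ y _ hx hy =>
      obtain ⟨w, hw, hwx⟩ := hx
      obtain ⟨v, hv, hvx⟩ := hy
      refine ⟨w + v, add_mem hw hv, ?_⟩
      rw [Subalgebra.coe_add, hwx, hvx, AddMonoidAlgebra.single_add]

/-- The family `n ↦ (b(n + g) : a)`. -/
def colonFamily (b : (Fin s → ℤ) → Ideal R) (g : Fin s → ℤ) (a : R) (n : Fin s → ℤ) : Ideal R :=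
  Submodule.comap (LinearMap.mulLeft R a) (b (n + g))

theorem mem_colonFamily {b : (Fin s → ℤ) → Ideal R} {g : Fin s → ℤ} {a : R} {n : Fin s → ℤ}
    {x : R} : x ∈ colonFamily b g a n ↔ a * x ∈ b (n + g) := Iff.rfl

theorem colonFamily_mul_le {I : Fin s → Ideal R} {b : (Fin s → ℤ) → Ideal R}
    (hb : ∀ n m, multiPow I n * b m ≤ b (n + m)) (g : Fin s → ℤ) (a : R) (n m : Fin s → ℤ) :
    multiPow I n * colonFamily b g a m ≤ colonFamily b g a (n + m) := by
  rw [Ideal.mul_le]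
  intro r hr x hx
  rw [mem_colonFamily] at hx ⊢
  rw [mul_left_comm, add_assoc]
  exact hb _ _ (Ideal.mul_mem_mul hr hx)

theorem le_of_span_singleton_mul_le {a : R} (ha : a ∈ nonZeroDivisors R) {J K : Ideal R}
    (h : Ideal.span {a} * J ≤ Ideal.span {a} * K) : J ≤ K := by
  intro x hx
  obtain ⟨y, hy, hxy⟩ := Ideal.mem_span_singleton_mul.mp
    (h (Ideal.mul_mem_mul (Ideal.mem_span_singleton_self a) hx))
  rw [mul_cancel_left_mem_nonZeroDivisors ha] at hxy
  exact hxy ▸ hy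

/-- Multiplication by a identifies the colon family with a subfamily of a shift of b. That subfamily
is finite by Noetherianity, and the nonzerodivisor a can be cancelled from the generation statement.
-/
theorem colonFamily_isFiniteFamily [IsNoetherianRing R] {I : Fin s → Ideal R}
    {b : (Fin s → ℤ) → Ideal R} (hb : ∀ n m, multiPow I n * b m ≤ b (n + m))
    (hfin : IsFiniteFamily I b) (g : Fin s → ℤ) {a : R} (ha : a ∈ nonZeroDivisors R) :
    IsFiniteFamily I (colonFamily b g a) := by
  have hc : ∀ n m, multiPow I n * (Ideal.span {a} * colonFamily b g a m) ≤
      Ideal.span {a} * colonFamily b g a (n + m) := by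
    intro n m
    rw [mul_left_comm]
    exact Ideal.mul_mono_right (colonFamily_mul_le hb g a n m)
  obtain ⟨D, hD⟩ := IsFiniteFamily.mono (b := fun n => Ideal.span {a} * colonFamily b g a n) hc
    (by
      intro n m
      rw [add_assoc]
      exact hb n (m + g)) (hfin.shift g) (by
      intro n
      rw [Ideal.span_singleton_mul_le_iff]
      exact fun x hx => mem_colonFamily.mp hx)
  refine ⟨D, fun n => le_of_span_singleton_mul_le ha ((hD n).trans_eq ?_)⟩
  simp only [Ideal.mul_iSup, mul_left_comm]

/-- The quotient need not be finitely generated, but τ = (t_1⋯t_s)⁻¹ acts on it locally nilpotently,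
and its kernel is contained in the image of the module of the shifted family n ↦ b(n - (1,…,1)),
which is finitely generated. -/
theorem associatedPrimes_laurentRing_quotient_finite [IsNoetherianRing R]
    {I : Fin s → Ideal R} {b : (Fin s → ℤ) → Ideal R}
    (hb : ∀ n m, multiPow I n * b m ≤ b (n + m)) (hfin : IsFiniteFamily I b)
    (h0 : ∀ n, n ≤ 0 → b n = ⊤) :
    (associatedPrimes (extReesRing I) (LaurentRing R s ⧸ familyModule I b hb)).Finite := by
  have := extReesRing_isNoetherianRing I
  set N := familyModule I b hb with hN
  set τ : extReesRing I := extReesSingle I (-1) 1 (by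
    rw [multiPow_of_nonpos I (by simp)]
    trivial) with hτ
  have hτpow : ∀ k : ℕ, ((τ ^ k : extReesRing I) : LaurentRing R s) =
      AddMonoidAlgebra.single (-(k : Fin s → ℤ)) 1 := by
    intro k
    rw [SubmonoidClass.coe_pow]
    refine (AddMonoidAlgebra.single_pow _ _ _).trans ?_
    simp
  have hnil : ∀ y : LaurentRing R s ⧸ N, ∃ k, τ ^ k • y = 0 := by
    intro y
    obtain ⟨f, rfl⟩ := Submodule.mkQ_surjective N y
    induction f using AddMonoidAlgebra.induction_linear with
    | zero => exact ⟨0, by simp⟩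
    | add f g hf hg =>
      obtain ⟨k, hk⟩ := hf
      obtain ⟨l, hl⟩ := hg
      refine ⟨k + l, ?_⟩
      rw [map_add, smul_add, pow_add, mul_smul, mul_smul, hl, smul_zero, add_zero, smul_comm, hk,
        smul_zero]
    | single n c =>
      -- The sum dominates every n_j, so this power of τ moves c tⁿ into degrees ≤ 0, where b is the
      -- whole ring.
      refine ⟨∑ j, (n j).toNat, ?_⟩
      rw [← map_smul, Submodule.mkQ_apply, Submodule.Quotient.mk_eq_zero, Subalgebra.smul_def,
        hτpow, smul_eq_mul, AddMonoidAlgebra.single_mul_single]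
      refine single_coeff_mem ?_
      rw [h0]
      · trivial
      · intro j
        have h1 : (n j).toNat ≤ ∑ j, (n j).toNat :=
          Finset.single_le_sum (f := fun j => (n j).toNat) (fun _ _ => Nat.zero_le _)
            (Finset.mem_univ j)
        simp only [Pi.add_apply, Pi.neg_apply, Pi.natCast_apply, Pi.zero_apply]
        omega
  have hker : (LinearMap.ker (LinearMap.lsmul (extReesRing I) (LaurentRing R s ⧸ N) τ)).FG := by
    have hb' : ∀ n m, multiPow I n * b (m + (-1)) ≤ b (n + m + (-1)) := fun n m => by
      rw [add_assoc]
      exact hb n _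
    have hT : ((familyModule I (fun n => b (n + (-1))) hb').map N.mkQ).FG :=
      (familyModule_fg hb' (hfin.shift (-1))).map _
    refine isNoetherian_submodule.mp (isNoetherian_of_fg_of_noetherian _ hT) _ fun y hy => ?_
    obtain ⟨f, rfl⟩ := Submodule.mkQ_surjective N y
    refine Submodule.mem_map_of_mem fun n => ?_
    rw [LinearMap.mem_ker, LinearMap.lsmul_apply, ← map_smul, Submodule.mkQ_apply,
      Submodule.Quotient.mk_eq_zero] at hy
    have h2 : (AddMonoidAlgebra.single (-1) 1 * f).coeff (n + (-1)) ∈ b (n + (-1)) := hy (n + (-1))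
    rwa [coeff_single_mul, one_mul, add_sub_cancel_right] at h2
  exact associatedPrimes_finite_of_locally_nilpotent τ hnil hker

theorem pow_mul_le_of_pow_span_range_le_annihilator {I : Fin s → Ideal R}
    {b c : (Fin s → ℤ) → Ideal R} (hb : ∀ n m, multiPow I n * b m ≤ b (n + m))
    (hc : ∀ n m, multiPow I n * c m ≤ c (n + m)) {i : Fin s} {K : ℕ}
    (hK : Ideal.span (Set.range (extReesDegreeOne I i)) ^ K ≤
      ((familyModule I c hc).map (familyModule I b hb).mkQ).annihilator) (n : Fin s → ℤ) :
    I i ^ K * c n ≤ b (n + Pi.single i (K : ℤ)) := by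
  rw [Ideal.mul_le]
  intro u hu z hz
  obtain ⟨w, hw, hwu⟩ := exists_mem_pow_span_range I i K u hu
  have h0 : AddMonoidAlgebra.single n z ∈ familyModule I c hc := single_coeff_mem hz
  have h1 := Submodule.mem_annihilator.mp (hK hw) _ (Submodule.mem_map_of_mem h0)
  rw [← map_smul, Submodule.mkQ_apply, Submodule.Quotient.mk_eq_zero] at h1
  have h2 : w • (AddMonoidAlgebra.single n z : LaurentRing R s) =
      AddMonoidAlgebra.single (n + Pi.single i (K : ℤ)) (u * z) := by
    rw [Subalgebra.smul_def, hwu, smul_eq_mul, AddMonoidAlgebra.single_mul_single, add_comm]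
  rw [h2] at h1
  have := h1 (n + Pi.single i (K : ℤ))
  rwa [AddMonoidAlgebra.coeff_single, Finsupp.single_eq_same] at this

/-- The element a t_i kills M/b, where M is the colon family (identified with its module). By the
condition on associated primes, some power (I_i t_i)ᴷ kills the image of M as well. For n_i large,
M(n) ⊆ I_iᴷ M(n - K e_i), and this lies in b(n). -/
theorem exists_colon_le_of_forall_associatedPrimes [IsNoetherianRing R]
    {I : Fin s → Ideal R} {b : (Fin s → ℤ) → Ideal R}
    (hb : ∀ n m, multiPow I n * b m ≤ b (n + m)) (hfin : IsFiniteFamily I b) {i : Fin s}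
    (a : I i) (ha : (a : R) ∈ nonZeroDivisors R)
    (h : ∀ P ∈ associatedPrimes (extReesRing I) (LaurentRing R s ⧸ familyModule I b hb),
      extReesDegreeOne I i a ∈ P → Ideal.span (Set.range (extReesDegreeOne I i)) ≤ P) :
    ∃ p₀ : ℤ, ∀ n : Fin s → ℤ, p₀ ≤ n i → ∀ x, (a : R) * x ∈ b (n + Pi.single i 1) → x ∈ b n := by
  have := extReesRing_isNoetherianRing I
  set M := colonFamily b (Pi.single i 1) (a : R) with hM
  have hMb : ∀ n m, multiPow I n * M m ≤ M (n + m) := colonFamily_mul_le hb _ _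
  have hMfin : IsFiniteFamily I M := colonFamily_isFiniteFamily hb hfin _ ha
  have hann : extReesDegreeOne I i a ∈
      ((familyModule I M hMb).map (familyModule I b hb).mkQ).annihilator := by
    rw [Submodule.mem_annihilator]
    rintro _ ⟨f, hf, rfl⟩
    rw [← map_smul, Submodule.mkQ_apply, Submodule.Quotient.mk_eq_zero]
    exact mul_single_mem_familySubmodule fun n => mem_colonFamily.mp (hf n)
  obtain ⟨K, hK⟩ := exists_pow_le_annihilator_of_associatedPrimes
    ((familyModule_fg hMb hMfin).map _) hann h
  obtain ⟨p₀, hp₀⟩ := hMfin.exists_le_pow_mul hMb i K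
  refine ⟨p₀, fun n hn x hx => ?_⟩
  have h1 := pow_mul_le_of_pow_span_range_le_annihilator hb hMb hK (n - Pi.single i (K : ℤ))
  rw [sub_add_cancel] at h1
  exact h1 (hp₀ n hn (mem_colonFamily.mpr hx))

/-- Existence of superficial elements: a sufficiently general element `a ∈ Iᵢ` is a nonzerodivisor
such that `(b(n + eᵢ) : a) = b(n)` whenever `nᵢ` is large. -/
theorem exists_superficial [IsNoetherianRing R] [IsLocalRing R] [Infinite (ResidueField R)]
    {I : Fin s → Ideal R} {b : (Fin s → ℤ) → Ideal R}
    (hb : ∀ n m, multiPow I n * b m ≤ b (n + m)) (hfin : IsFiniteFamily I b)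
    (h0 : ∀ n, n ≤ 0 → b n = ⊤) (i : Fin s)
    (hreg : ∀ P ∈ associatedPrimes R R, ¬ I i ≤ P) :
    ∃ a ∈ I i, a ∈ nonZeroDivisors R ∧ ∃ p₀ : ℤ, ∀ n : Fin s → ℤ, p₀ ≤ n i →
      ∀ x, a * x ∈ b (n + Pi.single i 1) → x ∈ b n := by
  have hass := associatedPrimes_laurentRing_quotient_finite hb hfin h0
  set N := familyModule I b hb with hN
  set 𝔞 := Ideal.span (Set.range (extReesDegreeOne I i)) with h𝔞
  -- `W₁` collects the conditions that make a superficial, from the finitely many associated primes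
  -- not containing I_i t_i; `W₂` collects those that make a a nonzerodivisor. All of them are
  -- proper submodules of I_i.
  let W₁ : Set (Submodule R (I i)) :=
    (fun P : Ideal (extReesRing I) => (P.restrictScalars R).comap (extReesDegreeOne I i)) ''
      {P ∈ associatedPrimes (extReesRing I) (LaurentRing R s ⧸ N) | ¬ 𝔞 ≤ P}
  let W₂ : Set (Submodule R (I i)) :=
    (fun P : Ideal R => Submodule.comap (I i).subtype P) '' associatedPrimes R R
  obtain ⟨⟨a, haI⟩, ha⟩ := Submodule.exists_forall_notMem_of_infinite_residueField (W := W₁ ∪ W₂)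
    (((hass.subset fun P hP => hP.1).image _).union ((associatedPrimes.finite R R).image _)) (by
      rintro (⟨P, ⟨_, hP⟩, hPtop⟩ | ⟨P, hP, hPtop⟩)
      · refine hP (Ideal.span_le.mpr ?_)
        rintro _ ⟨c, rfl⟩
        exact (hPtop.symm ▸ Submodule.mem_top : c ∈ (P.restrictScalars R).comap _)
      · refine hreg P hP fun c hc => ?_
        have hPtop : Submodule.comap (I i).subtype P = ⊤ := hPtop
        exact (hPtop.symm ▸ Submodule.mem_top : (⟨c, hc⟩ : I i) ∈ Submodule.comap (I i).subtype P))
  have hanzd : a ∈ nonZeroDivisors R := by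
    by_contra hne
    have : a ∈ ⋃ p ∈ associatedPrimes R R, (p : Set R) := by
      rw [biUnion_associatedPrimes_eq_compl_nonZeroDivisors]
      exact hne
    obtain ⟨P, hP, haP⟩ := Set.mem_iUnion₂.mp this
    exact ha _ (Or.inr ⟨P, hP, rfl⟩) haP
  refine ⟨a, haI, hanzd, exists_colon_le_of_forall_associatedPrimes hb hfin ⟨a, haI⟩ hanzd ?_⟩
  intro P hP haP
  by_contra hle
  exact ha _ (Or.inl ⟨P, ⟨hP, hle⟩, rfl⟩) haP

end Superficial

/-! ### Cohen-Macaulay local rings, principal and joint reductions -/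

section LocalRing

theorem mem_nonZeroDivisors_of_isSMulRegular {R : Type*} [CommRing R] {x : R} (hx : IsSMulRegular R x) :
    x ∈ nonZeroDivisors R := by
  rw [mem_nonZeroDivisors_iff_right]
  intro z hz
  refine hx ?_
  simp only [smul_eq_mul, mul_zero]
  rwa [mul_comm]

variable {R : Type*} [CommRing R] [IsLocalRing R]

theorem IsCohenMacaulayLocal.exists_nonZeroDivisor {d : ℕ} (h : IsCohenMacaulayLocal R)
    (hd : ringKrullDim R = d) (hd1 : 1 ≤ d) : ∃ x ∈ maximalIdeal R, x ∈ nonZeroDivisors R := by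
  obtain ⟨rs, hmem, hreg, hlen⟩ := h
  rw [hd] at hlen
  have hlen : rs.length = d := by exact_mod_cast hlen
  rcases rs with _ | ⟨x, rs⟩
  · simp at hlen
    omega
  · have := ((RingTheory.Sequence.isRegular_cons_iff _ _ _).mp hreg).1
    exact ⟨x, hmem x (by simp), mem_nonZeroDivisors_of_isSMulRegular this⟩

theorem IsCohenMacaulayLocal.exists_regular_pair (h : IsCohenMacaulayLocal R)
    (hd : ringKrullDim R = 2) : ∃ x ∈ maximalIdeal R, ∃ y ∈ maximalIdeal R,
      x ∈ nonZeroDivisors R ∧ ∀ u v, y * u = x * v → ∃ w, u = x * w := by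
  obtain ⟨rs, hmem, hreg, hlen⟩ := h
  rw [hd] at hlen
  have hlen : rs.length = 2 := by exact_mod_cast hlen
  obtain ⟨x, y, rfl⟩ := List.length_eq_two.mp hlen
  obtain ⟨hx, hreg⟩ := (RingTheory.Sequence.isRegular_cons_iff _ _ _).mp hreg
  have hy := ((RingTheory.Sequence.isRegular_cons_iff _ _ _).mp hreg).1
  refine ⟨x, hmem x (by simp), y, hmem y (by simp), mem_nonZeroDivisors_of_isSMulRegular hx,
    fun u v huv => ?_⟩
  have h0 : y • (Submodule.Quotient.mk u : QuotSMulTop x R) = y • 0 := by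
    rw [smul_zero, ← Submodule.Quotient.mk_smul, Submodule.Quotient.mk_eq_zero,
      Submodule.mem_smul_pointwise_iff_exists]
    exact ⟨v, trivial, huv.symm⟩
  have h1 := hy h0
  rw [Submodule.Quotient.mk_eq_zero, Submodule.mem_smul_pointwise_iff_exists] at h1
  obtain ⟨w, _, hw⟩ := h1
  exact ⟨w, hw.symm⟩

theorem maximalIdeal_notMem_associatedPrimes [IsNoetherianRing R]
    (h : ∃ x ∈ maximalIdeal R, x ∈ nonZeroDivisors R) :
    maximalIdeal R ∉ associatedPrimes R R := by
  obtain ⟨x, hx, hreg⟩ := h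
  intro hP
  have : x ∈ ⋃ p ∈ associatedPrimes R R, (p : Set R) := Set.mem_biUnion hP hx
  rw [biUnion_associatedPrimes_eq_compl_nonZeroDivisors] at this
  exact this hreg

/-- If `x, y` is a regular sequence in the maximal ideal and `a` is a nonzerodivisor in it, then
`R / a` has positive depth. -/
theorem maximalIdeal_notMem_associatedPrimes_quotient [IsNoetherianRing R] {x y : R}
    (hx : x ∈ maximalIdeal R) (hy : y ∈ maximalIdeal R)
    (hxy : ∀ u v, y * u = x * v → ∃ w, u = x * w) (hxreg : x ∈ nonZeroDivisors R)
    {a : R} (ha : a ∈ nonZeroDivisors R) [IsLocalRing (R ⧸ Ideal.span {a})]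
    [IsLocalHom (Ideal.Quotient.mk (Ideal.span {a}))] :
    maximalIdeal (R ⧸ Ideal.span {a}) ∉ associatedPrimes _ (R ⧸ Ideal.span {a}) := by
  rw [AssociatedPrimes.mem_iff, isAssociatedPrime_iff]
  rintro ⟨hprime, z, hz⟩
  obtain ⟨z, rfl⟩ := Ideal.Quotient.mk_surjective z
  have key : ∀ t ∈ maximalIdeal R, ∃ w, t * z = a * w := by
    intro t ht
    have : Ideal.Quotient.mk (Ideal.span {a}) t ∈ maximalIdeal (R ⧸ Ideal.span {a}) :=
      map_nonunit _ t ht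
    rw [hz, Submodule.mem_colon_singleton, Submodule.mem_bot, smul_eq_mul, ← map_mul,
      Ideal.Quotient.eq_zero_iff_mem, Ideal.mem_span_singleton] at this
    exact this
  obtain ⟨w, hw⟩ := key x hx
  obtain ⟨v, hv⟩ := key y hy
  -- Here xz = aw and yz = av. Cancelling a gives yw = xv, so x divides w; cancelling x then puts z
  -- in (a), contradicting that the annihilator of z is proper.
  have h1 : y * w = x * v := by
    rw [← mul_cancel_left_mem_nonZeroDivisors ha]
    linear_combination x * hv - y * hw
  obtain ⟨t, rfl⟩ := hxy _ _ h1
  have h2 : z = a * t := by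
    rw [← mul_cancel_left_mem_nonZeroDivisors hxreg]
    linear_combination hw
  refine hprime.ne_top ((Ideal.eq_top_iff_one _).mpr ?_)
  rw [hz, Submodule.mem_colon_singleton, Submodule.mem_bot, one_smul,
    Ideal.Quotient.eq_zero_iff_mem, Ideal.mem_span_singleton]
  exact ⟨t, h2⟩

theorem isLocalRing_quotient_span_singleton {a : R} (ha : a ∈ maximalIdeal R) :
    IsLocalRing (R ⧸ Ideal.span {a}) := by
  have : Nontrivial (R ⧸ Ideal.span {a}) := by
    rw [Ideal.Quotient.nontrivial_iff, ne_eq, Ideal.span_singleton_eq_top]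
    exact ha
  exact IsLocalRing.of_surjective' (Ideal.Quotient.mk _) Ideal.Quotient.mk_surjective

/-- Killing a nonzerodivisor lowers the dimension, so R/a is Artinian and its maximal ideal is
nilpotent. -/
theorem maximalIdeal_pow_le_span_of_ringKrullDim_eq_one [IsNoetherianRing R]
    (hdim : ringKrullDim R = 1) {a : R} (ha : a ∈ nonZeroDivisors R) (ham : a ∈ maximalIdeal R) :
    ∃ k, maximalIdeal R ^ k ≤ Ideal.span {a} := by
  have := isLocalRing_quotient_span_singleton ham
  have : IsLocalHom (Ideal.Quotient.mk (Ideal.span {a})) :=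
    IsLocalHom.of_surjective _ Ideal.Quotient.mk_surjective
  have hle := ringKrullDim_quotient_succ_le_of_nonZeroDivisor ha
  have : Ring.KrullDimLE 0 (R ⧸ Ideal.span {a}) := by
    rw [Ring.krullDimLE_iff]
    rw [hdim] at hle
    generalize ringKrullDim (R ⧸ Ideal.span {a}) = D at hle
    induction D using WithBot.recBotCoe with
    | bot => exact bot_le
    | coe D =>
      have h1 : D + 1 ≤ 1 := by exact_mod_cast hle
      have h2 : D ≤ 0 := by
        induction D using ENat.recTopCoe with
        | top => simp at h1
        | coe D =>
          norm_cast at h1 ⊢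
          omega
      exact_mod_cast h2
  obtain ⟨k, hk⟩ := (isArtinianRing_iff_isNilpotent_maximalIdeal (R ⧸ Ideal.span {a})).mp
    (isArtinianRing_iff_krullDimLE_zero.mpr this)
  refine ⟨k, ?_⟩
  rw [← Ideal.mk_ker (I := Ideal.span {a}), ← Ideal.map_eq_bot_iff_le_ker, Ideal.map_pow, eq_bot_iff]
  exact (Ideal.pow_right_mono (map_maximalIdeal_le _) k).trans_eq hk

theorem not_le_of_mem_associatedPrimes {J : Ideal R}
    (hdepth : maximalIdeal R ∉ associatedPrimes R R) (hJ : ∃ k, maximalIdeal R ^ k ≤ J)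
    {P : Ideal R} (hP : P ∈ associatedPrimes R R) : ¬ J ≤ P := by
  intro hle
  obtain ⟨k, hk⟩ := hJ
  have hprime : P.IsPrime := hP.isPrime
  have h1 : maximalIdeal R ≤ P := hprime.le_of_pow_le (hk.trans hle)
  exact hdepth (le_antisymm (le_maximalIdeal hprime.ne_top) h1 ▸ hP)

theorem zero_le_single_one {s : ℕ} (i j : Fin s) : (0 : ℤ) ≤ (Pi.single i 1 : Fin s → ℤ) j := by
  rw [Pi.single_apply]
  split_ifs <;> norm_num

variable [IsNoetherianRing R] [Infinite (ResidueField R)] {s : ℕ}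

/-- In dimension one, a finite family has a principal reduction in each direction. -/
theorem exists_principal_reduction (hdim : ringKrullDim R = 1)
    (hdepth : maximalIdeal R ∉ associatedPrimes R R) {I : Fin s → Ideal R}
    (hIm : ∀ i, I i ≤ maximalIdeal R) (hmI : ∀ i, ∃ k, maximalIdeal R ^ k ≤ I i)
    {b : (Fin s → ℤ) → Ideal R} (hb : ∀ n m, multiPow I n * b m ≤ b (n + m))
    (hfin : IsFiniteFamily I b) (h0 : ∀ n, n ≤ 0 → b n = ⊤) (i : Fin s) :
    ∃ a ∈ I i, a ∈ nonZeroDivisors R ∧ (∃ k, maximalIdeal R ^ k ≤ Ideal.span {a}) ∧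
      ∃ p₀ : ℤ, ∀ n : Fin s → ℤ, p₀ ≤ n i → b (n + Pi.single i 1) ≤ Ideal.span {a} * b n := by
  obtain ⟨a, haI, ha, p, hp⟩ := exists_superficial hb hfin h0 i
    fun _ => not_le_of_mem_associatedPrimes hdepth (hmI i)
  obtain ⟨k, hk⟩ := maximalIdeal_pow_le_span_of_ringKrullDim_eq_one hdim ha (hIm i haI)
  obtain ⟨q, hq⟩ := hfin.exists_le_pow_mul hb i k
  refine ⟨a, haI, ha, ⟨k, hk⟩, max p q, fun n hn x hx => ?_⟩
  -- For n_i large, b(n + e_i) ⊆ I_iᵏ ⊆ 𝔪ᵏ ⊆ (a). Every element is therefore a multiple a y, and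
  -- superficiality puts y in b(n).
  have hxa : x ∈ Ideal.span {a} := by
    have hqn : q ≤ (n + Pi.single i 1 : Fin s → ℤ) i := by
      have := (le_max_right p q).trans hn
      simp only [Pi.add_apply, Pi.single_eq_same]
      omega
    have h1 : b (n + Pi.single i 1) ≤ I i ^ k := (hq _ hqn).trans Ideal.mul_le_left
    exact hk (Ideal.pow_right_mono (hIm i) k (h1 hx))
  obtain ⟨y, rfl⟩ := Ideal.mem_span_singleton.mp hxa
  exact Ideal.mul_mem_mul (Ideal.mem_span_singleton_self a)
    (hp n ((le_max_left p q).trans hn) y hx)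

/-- In a two-dimensional Cohen-Macaulay ring, a finite family has joint reductions. -/
theorem exists_joint_reduction (hdim : ringKrullDim R = 2) (hCM : IsCohenMacaulayLocal R)
    {I : Fin s → Ideal R} (hIm : ∀ i, I i ≤ maximalIdeal R)
    (hmI : ∀ i, ∃ k, maximalIdeal R ^ k ≤ I i)
    {b : (Fin s → ℤ) → Ideal R} (hb : ∀ n m, multiPow I n * b m ≤ b (n + m))
    (hfin : IsFiniteFamily I b) (h0 : ∀ n, n ≤ 0 → b n = ⊤) (i j : Fin s) :
    ∃ a ∈ I i, ∃ c ∈ I j, a ∈ nonZeroDivisors R ∧ (∀ u v, c * u = a * v → ∃ w, u = a * w) ∧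
      (∃ k, maximalIdeal R ^ k ≤ Ideal.span {a} ⊔ Ideal.span {c}) ∧
      ∃ p₀ : ℤ, (∀ n : Fin s → ℤ, p₀ ≤ n i → ∀ x, a * x ∈ b (n + Pi.single i 1) → x ∈ b n) ∧
        ∀ n : Fin s → ℤ, p₀ ≤ n i → p₀ ≤ n j → b (n + Pi.single i 1 + Pi.single j 1) ≤
          Ideal.span {a} * b (n + Pi.single j 1) ⊔ Ideal.span {c} * b (n + Pi.single i 1) := by
  obtain ⟨x, hx, y, hy, hxreg, hxy⟩ := hCM.exists_regular_pair hdim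
  obtain ⟨a, haI, ha, p, hp⟩ := exists_superficial hb hfin h0 i fun _ =>
    not_le_of_mem_associatedPrimes (maximalIdeal_notMem_associatedPrimes ⟨x, hx, hxreg⟩) (hmI i)
  have ham := hIm i haI
  have := isLocalRing_quotient_span_singleton ham
  set π := Ideal.Quotient.mk (Ideal.span {a}) with hπ
  have hπs : Function.Surjective π := Ideal.Quotient.mk_surjective
  have : IsLocalHom π := IsLocalHom.of_surjective _ hπs
  have : Infinite (ResidueField (R ⧸ Ideal.span {a})) :=
    Infinite.of_injective (ResidueField.map π) (ResidueField.map π).injective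
  have hdim' : ringKrullDim (R ⧸ Ideal.span {a}) = 1 := by
    have h1 := ringKrullDim_quotient_span_singleton_succ_eq_ringKrullDim_of_mem_jacobson
      (x := a) (by
        intro u v huv
        exact (mul_cancel_left_mem_nonZeroDivisors ha).mp huv) (by
        rw [IsLocalRing.ringJacobson_eq_maximalIdeal]
        exact ham)
    rw [hdim] at h1
    generalize ringKrullDim (R ⧸ Ideal.span {a}) = D at h1
    induction D using WithBot.recBotCoe with
    | bot => simp at h1
    | coe D =>
      have h1 : D + 1 = 2 := WithBot.coe_injective h1
      induction D using ENat.recTopCoe with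
      | top => simp at h1
      | coe D =>
        norm_cast at h1 ⊢
        omega
  have hmap : maximalIdeal (R ⧸ Ideal.span {a}) = (maximalIdeal R).map π := by
    rw [← IsLocalRing.maximalIdeal_comap π, Ideal.map_comap_of_surjective _ hπs]
  have hmul : ∀ (t : R) (J : Ideal R) (z : R), π z ∈ Ideal.span {π t} * J.map π →
      ∃ w ∈ J, ∃ v, z = t * w + a * v := by
    intro t J z hz
    obtain ⟨w', hw', hzw⟩ := Ideal.mem_span_singleton_mul.mp hz
    obtain ⟨w, hw, rfl⟩ := (Ideal.mem_map_iff_of_surjective π hπs).mp hw'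
    rw [← map_mul, eq_comm, ← sub_eq_zero, ← map_sub, Ideal.Quotient.eq_zero_iff_mem,
      Ideal.mem_span_singleton] at hzw
    obtain ⟨v, hv⟩ := hzw
    exact ⟨w, hw, v, by rw [← hv]; ring⟩
  obtain ⟨c', hcI', hc', ⟨k, hk⟩, q, hq⟩ := exists_principal_reduction (i := j)
    (b := fun n => (b n).map π) hdim'
    (maximalIdeal_notMem_associatedPrimes_quotient hx hy hxy hxreg ha)
    (I := fun i => (I i).map π) (fun l => hmap ▸ Ideal.map_mono (hIm l))
    (fun l => by
      obtain ⟨k, hk⟩ := hmI l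
      refine ⟨k, ?_⟩
      rw [hmap, ← Ideal.map_pow]
      exact Ideal.map_mono hk)
    (fun n m => by
      rw [multiPow_map, ← Ideal.map_mul]
      exact Ideal.map_mono (hb n m)) (hfin.map π) (fun n hn => by rw [h0 n hn, Ideal.map_top])
  obtain ⟨c, hcI, rfl⟩ := (Ideal.mem_map_iff_of_surjective π hπs).mp hcI'
  refine ⟨a, haI, c, hcI, ha, ?_, ⟨k, ?_⟩, max p q, ?_, ?_⟩
  · intro u v huv
    have h1 : π c * π u = 0 := by
      rw [← map_mul, huv, Ideal.Quotient.eq_zero_iff_mem, Ideal.mem_span_singleton]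
      exact ⟨v, rfl⟩
    rw [mul_left_mem_nonZeroDivisors_eq_zero_iff hc', Ideal.Quotient.eq_zero_iff_mem,
      Ideal.mem_span_singleton] at h1
    exact h1
  · intro z hz
    have h1 : π z ∈ Ideal.span {π c} * (⊤ : Ideal R).map π := by
      rw [Ideal.map_top, Ideal.mul_top]
      refine hk ?_
      rw [hmap, ← Ideal.map_pow]
      exact Ideal.mem_map_of_mem π hz
    obtain ⟨w, _, v, rfl⟩ := hmul _ _ _ h1
    rw [add_comm]
    exact Submodule.add_mem_sup (Ideal.mem_span_singleton.mpr ⟨v, rfl⟩)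
      (Ideal.mem_span_singleton.mpr ⟨w, rfl⟩)
  · exact fun n hn => hp n ((le_max_left p q).trans hn)
  · intro n hni hnj z hz
    obtain ⟨w, hw, v, rfl⟩ := hmul _ _ _ (hq (n + Pi.single i 1) (by
      have h1 := (le_max_right p q).trans hnj
      have h2 := zero_le_single_one i j
      simp only [Pi.add_apply]
      omega) (Ideal.mem_map_of_mem π hz))
    -- The equality modulo a lifts to z = cw + av with w in b(n + e_i). Then av = z - cw lies in b(n
    -- + e_i + e_j), and superficiality of a puts v in b(n + e_j).
    have h1 : c * w ∈ b (n + Pi.single i 1 + Pi.single j 1) := by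
      rw [add_comm _ (Pi.single j 1)]
      refine hb _ _ (Ideal.mul_mem_mul ?_ hw)
      rwa [multiPow_single_one]
    have h2 : a * v ∈ b (n + Pi.single j 1 + Pi.single i 1) := by
      rw [add_right_comm]
      exact (Ideal.add_mem_iff_right _ h1).mp hz
    have h3 := hp (n + Pi.single j 1) (by
      have h1 := (le_max_left p q).trans hni
      have h2 := zero_le_single_one j i
      simp only [Pi.add_apply]
      omega) v h2
    rw [add_comm (c * w)]
    exact Submodule.add_mem_sup (Ideal.mul_mem_mul (Ideal.mem_span_singleton_self a) h3)
      (Ideal.mul_mem_mul (Ideal.mem_span_singleton_self c) hw)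

end LocalRing

/-! ### Colengths of a J and of a J + c K -/

section Length

variable {R : Type*} [CommRing R]

theorem length_eq_length_ker_add_length_range {M N : Type*} [AddCommGroup M] [Module R M]
    [AddCommGroup N] [Module R N] (f : M →ₗ[R] N) :
    Module.length R M = Module.length R (LinearMap.ker f) + Module.length R (LinearMap.range f) :=
  Module.length_eq_add_of_exact (LinearMap.ker f).subtype f.rangeRestrict
    (Submodule.injective_subtype _) f.surjective_rangeRestrict (by
      rw [LinearMap.exact_iff, LinearMap.ker_rangeRestrict, Submodule.range_subtype])

theorem length_quotient_ker_eq_length_range {M N : Type*} [AddCommGroup M] [Module R M]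
    [AddCommGroup N] [Module R N] (f : M →ₗ[R] N) :
    Module.length R (M ⧸ LinearMap.ker f) = Module.length R (LinearMap.range f) :=
  f.quotKerEquivRange.length_eq

/-- For a regular sequence `a, c`, the colength of `a J + c K`. -/
theorem length_quotient_span_mul_sup_span_mul {a c : R} (ha : a ∈ nonZeroDivisors R)
    (hac : ∀ u v, c * u = a * v → ∃ w, u = a * w) (J K : Ideal R) :
    Module.length R (R ⧸ (Ideal.span {a} * J ⊔ Ideal.span {c} * K)) +
        Module.length R (R ⧸ (Submodule.comap (LinearMap.mulLeft R c) J ⊓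
          Submodule.comap (LinearMap.mulLeft R a) K)) =
      Module.length R (R ⧸ (Ideal.span {a} ⊔ Ideal.span {c})) +
        (Module.length R (R ⧸ J) + Module.length R (R ⧸ K)) := by
  set L : Ideal R := Ideal.span {a} * J ⊔ Ideal.span {c} * K with hL
  -- The maps x ↦ (cx, -ax) and (u, v) ↦ au + cv give the exact sequence 0 → R/((J : c) ∩ (K : a)) →
  -- R/J × R/K → R/(aJ + cK) → R/(a, c) → 0, whose exactness in the middle uses the regularity of a,
  -- c.
  let φ : R →ₗ[R] (R ⧸ J) × (R ⧸ K) :=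
    (J.mkQ ∘ₗ LinearMap.mulLeft R c).prod (K.mkQ ∘ₗ (-LinearMap.mulLeft R a))
  have hJL : J ≤ Submodule.comap (LinearMap.mulLeft R a) L := fun x hx =>
    Submodule.mem_sup_left (Ideal.mul_mem_mul (Ideal.mem_span_singleton_self a) hx)
  have hKL : K ≤ Submodule.comap (LinearMap.mulLeft R c) L := fun x hx =>
    Submodule.mem_sup_right (Ideal.mul_mem_mul (Ideal.mem_span_singleton_self c) hx)
  let ψ : (R ⧸ J) × (R ⧸ K) →ₗ[R] R ⧸ L :=
    (Submodule.mapQ J L _ hJL).coprod (Submodule.mapQ K L _ hKL)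
  let π : (R ⧸ L) →ₗ[R] R ⧸ (Ideal.span {a} ⊔ Ideal.span {c}) :=
    Submodule.factor (sup_le_sup Ideal.mul_le_left Ideal.mul_le_left)
  have hkerφ : LinearMap.ker φ = Submodule.comap (LinearMap.mulLeft R c) J ⊓
      Submodule.comap (LinearMap.mulLeft R a) K := by
    ext x
    simp only [φ, LinearMap.ker_prod, Submodule.mem_inf, LinearMap.mem_ker, LinearMap.comp_apply,
      Submodule.mkQ_apply, Submodule.Quotient.mk_eq_zero, Submodule.mem_comap, LinearMap.neg_apply,
      neg_mem_iff]
  have hψφ : LinearMap.ker ψ = LinearMap.range φ := by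
    ext ⟨u, v⟩
    obtain ⟨u, rfl⟩ := Submodule.mkQ_surjective J u
    obtain ⟨v, rfl⟩ := Submodule.mkQ_surjective K v
    have h1 : ψ (J.mkQ u, K.mkQ v) = L.mkQ (a * u + c * v) := rfl
    rw [LinearMap.mem_ker, h1, Submodule.mkQ_apply, Submodule.Quotient.mk_eq_zero,
      LinearMap.mem_range]
    constructor
    · intro h
      obtain ⟨p, hp, q, hq, hpq⟩ := Submodule.mem_sup.mp h
      obtain ⟨j, hj, rfl⟩ := Ideal.mem_span_singleton_mul.mp hp
      obtain ⟨k, hk, rfl⟩ := Ideal.mem_span_singleton_mul.mp hq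
      obtain ⟨w, hw⟩ := hac (v - k) (j - u) (by linear_combination -hpq)
      have h2 : j - u = c * w := by
        rw [← mul_cancel_left_mem_nonZeroDivisors ha]
        linear_combination hpq + c * hw
      refine ⟨-w, Prod.ext ?_ ?_⟩
      · change Submodule.Quotient.mk (c * -w) = Submodule.Quotient.mk u
        rw [Submodule.Quotient.eq]
        convert J.neg_mem hj using 1
        linear_combination h2
      · change Submodule.Quotient.mk (-(a * -w)) = Submodule.Quotient.mk v
        rw [Submodule.Quotient.eq]
        convert K.neg_mem hk using 1
        linear_combination -hw
    · rintro ⟨w, hw⟩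
      obtain ⟨hu, hv⟩ := Prod.ext_iff.mp hw
      have hu : c * w - u ∈ J := (Submodule.Quotient.eq J).mp hu
      have hv : -(a * w) - v ∈ K := (Submodule.Quotient.eq K).mp hv
      have := L.neg_mem (L.add_mem (hJL hu) (hKL hv))
      convert this using 1
      simp only [LinearMap.mulLeft_apply]
      ring
  have hπψ : LinearMap.ker π = LinearMap.range ψ := by
    ext z
    obtain ⟨z, rfl⟩ := Submodule.mkQ_surjective L z
    have h1 : π (L.mkQ z) = Submodule.Quotient.mk z := rfl
    rw [LinearMap.mem_ker, h1, Submodule.Quotient.mk_eq_zero, LinearMap.mem_range]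
    constructor
    · intro h
      obtain ⟨p, hp, q, hq, rfl⟩ := Submodule.mem_sup.mp h
      obtain ⟨u, rfl⟩ := Ideal.mem_span_singleton.mp hp
      obtain ⟨v, rfl⟩ := Ideal.mem_span_singleton.mp hq
      exact ⟨(J.mkQ u, K.mkQ v), rfl⟩
    · rintro ⟨⟨u, v⟩, huv⟩
      obtain ⟨u, rfl⟩ := Submodule.mkQ_surjective J u
      obtain ⟨v, rfl⟩ := Submodule.mkQ_surjective K v
      have h2 : a * u + c * v - z ∈ L := (Submodule.Quotient.eq L).mp huv
      have h3 := (sup_le_sup Ideal.mul_le_left Ideal.mul_le_left :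
        L ≤ Ideal.span {a} ⊔ Ideal.span {c}) h2
      have h4 : a * u + c * v ∈ Ideal.span {a} ⊔ Ideal.span {c} :=
        Submodule.add_mem_sup (Ideal.mem_span_singleton.mpr ⟨u, rfl⟩)
          (Ideal.mem_span_singleton.mpr ⟨v, rfl⟩)
      convert sub_mem h4 h3 using 1
      ring
  have hπ : LinearMap.range π = ⊤ := LinearMap.range_eq_top.mpr (Submodule.factor_surjective _)
  have e1 := length_eq_length_ker_add_length_range ψ
  have e2 := length_eq_length_ker_add_length_range π
  have e3 := length_quotient_ker_eq_length_range φ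
  rw [hπ, Module.length_top, hπψ] at e2
  rw [hψφ, Module.length_prod] at e1
  rw [hkerφ] at e3
  rw [e1, e2, e3]
  abel

/-- Multiplication by a induces an isomorphism from R/J onto aR/aJ. -/
theorem length_quotient_span_mul {a : R} (ha : a ∈ nonZeroDivisors R) (J : Ideal R) :
    Module.length R (R ⧸ (Ideal.span {a} * J)) =
      Module.length R (R ⧸ Ideal.span {a}) + Module.length R (R ⧸ J) := by
  set L : Ideal R := Ideal.span {a} * J with hL
  have hle : L ≤ Ideal.span {a} := Ideal.mul_le_left
  let φ : R →ₗ[R] R ⧸ L := L.mkQ ∘ₗ LinearMap.mulLeft R a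
  let π : (R ⧸ L) →ₗ[R] R ⧸ Ideal.span {a} := Submodule.factor hle
  have hkerφ : LinearMap.ker φ = J := by
    ext x
    simp only [φ, LinearMap.mem_ker, LinearMap.comp_apply, Submodule.mkQ_apply,
      Submodule.Quotient.mk_eq_zero, LinearMap.mulLeft_apply]
    constructor
    · intro h
      obtain ⟨y, hy, hxy⟩ := Ideal.mem_span_singleton_mul.mp h
      rw [mul_cancel_left_mem_nonZeroDivisors ha] at hxy
      exact hxy ▸ hy
    · exact fun h => Ideal.mul_mem_mul (Ideal.mem_span_singleton_self a) h
  have hπφ : LinearMap.ker π = LinearMap.range φ := by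
    ext z
    obtain ⟨z, rfl⟩ := Submodule.mkQ_surjective L z
    have h1 : π (L.mkQ z) = Submodule.Quotient.mk z := rfl
    rw [LinearMap.mem_ker, h1, Submodule.Quotient.mk_eq_zero, LinearMap.mem_range]
    constructor
    · intro h
      obtain ⟨u, rfl⟩ := Ideal.mem_span_singleton.mp h
      exact ⟨u, rfl⟩
    · rintro ⟨u, hu⟩
      have h2 : a * u - z ∈ L := (Submodule.Quotient.eq L).mp hu
      convert sub_mem (Ideal.mem_span_singleton.mpr ⟨u, rfl⟩) (hle h2) using 1
      ring
  have hπ : LinearMap.range π = ⊤ := LinearMap.range_eq_top.mpr (Submodule.factor_surjective _)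
  have e2 := length_eq_length_ker_add_length_range π
  have e3 := length_quotient_ker_eq_length_range φ
  rw [hπ, Module.length_top, hπφ] at e2
  rw [hkerφ] at e3
  rw [e2, e3, add_comm]

theorem length_quotient_anti {J K : Ideal R} (h : J ≤ K) :
    Module.length R (R ⧸ K) ≤ Module.length R (R ⧸ J) :=
  Module.length_le_of_surjective (Submodule.factor h) (Submodule.factor_surjective h)

theorem length_quotient_ne_top [IsLocalRing R] [IsNoetherianRing R] {J : Ideal R}
    (h : ∃ k, maximalIdeal R ^ k ≤ J) : Module.length R (R ⧸ J) ≠ ⊤ := by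
  obtain ⟨k, hk⟩ := h
  by_cases hJ : J = ⊤
  · subst hJ
    rw [Module.length_eq_zero]
    simp
  have : Nontrivial (R ⧸ J) := Ideal.Quotient.nontrivial_iff.mpr hJ
  have hs : Function.Surjective (Ideal.Quotient.mk J) := Ideal.Quotient.mk_surjective
  have : IsLocalRing (R ⧸ J) := IsLocalRing.of_surjective' _ hs
  have : IsLocalHom (Ideal.Quotient.mk J) := IsLocalHom.of_surjective _ hs
  have hart : IsArtinianRing (R ⧸ J) := by
    rw [isArtinianRing_iff_isNilpotent_maximalIdeal]
    refine ⟨k, ?_⟩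
    rw [← Ideal.map_comap_of_surjective _ hs (maximalIdeal (R ⧸ J)),
      IsLocalRing.maximalIdeal_comap, ← Ideal.map_pow, Ideal.zero_eq_bot,
      Ideal.map_eq_bot_iff_le_ker, Ideal.mk_ker]
    exact hk
  have h1 : Module.length (R ⧸ J) (R ⧸ J) ≠ ⊤ := Module.length_ne_top
  rwa [← Module.length_eq_of_surjective (R := R ⧸ J) (S := R) hs] at h1

end Length

/-! ### Numerical polynomials and their differences -/

section NumericalPolynomials

variable {s : ℕ}

/-- The index set `{α | |α| ≤ d}` of numerical polynomials of degree `d`. -/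
def degreeLE (s d : ℕ) : Finset (Fin s → ℕ) :=
  (Finset.Iic (fun _ : Fin s => d)).filter (fun α => ∑ i, α i ≤ d)

theorem mem_degreeLE {d : ℕ} {α : Fin s → ℕ} : α ∈ degreeLE s d ↔ ∑ i, α i ≤ d := by
  unfold degreeLE
  rw [Finset.mem_filter, Finset.mem_Iic, and_iff_right_iff_imp]
  intro h i
  exact (Finset.single_le_sum (fun j _ => Nat.zero_le (α j)) (Finset.mem_univ i)).trans h

/-- The product `∏ᵢ binom(nᵢ + αᵢ - 1, αᵢ)`. -/
def multiBinom (n : Fin s → ℤ) (α : Fin s → ℕ) : ℤ :=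
  ∏ i, Ring.choose (n i + α i - 1) (α i)

theorem numericalPoly_eq (d : ℕ) (e : (Fin s → ℕ) → ℤ) (n : Fin s → ℤ) :
    numericalPoly d e n =
      ∑ α ∈ degreeLE s d, (-1) ^ (d - ∑ i, α i) * e α * multiBinom n α := rfl

theorem multiBinom_add_single_of_eq_zero {n : Fin s → ℤ} {α : Fin s → ℕ} {i : Fin s}
    (h : α i = 0) : multiBinom (n + Pi.single i 1) α = multiBinom n α := by
  refine Finset.prod_congr rfl fun j _ => ?_
  by_cases hj : j = i
  · subst hj
    rw [h, Ring.choose_zero_right, Ring.choose_zero_right]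
  · rw [Pi.add_apply, Pi.single_eq_of_ne hj, add_zero]

theorem multiBinom_pascal (n : Fin s → ℤ) (α : Fin s → ℕ) (i : Fin s) :
    multiBinom (n + Pi.single i 1) (α + Pi.single i 1) - multiBinom n (α + Pi.single i 1) =
      multiBinom (n + Pi.single i 1) α := by
  unfold multiBinom
  rw [← Finset.mul_prod_erase _ _ (Finset.mem_univ i),
    ← Finset.mul_prod_erase (a := i) _ _ (Finset.mem_univ i),
    ← Finset.mul_prod_erase (a := i) _ _ (Finset.mem_univ i)]
  have h : ∀ (m : Fin s → ℤ), ∀ β : Fin s → ℕ, (∀ j ≠ i, m j = n j) → (∀ j ≠ i, β j = α j) →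
      ∏ j ∈ Finset.univ.erase i, Ring.choose (m j + β j - 1) (β j) =
        ∏ j ∈ Finset.univ.erase i, Ring.choose (n j + α j - 1) (α j) := by
    intro m β hm hβ
    refine Finset.prod_congr rfl fun j hj => ?_
    rw [hm j (Finset.ne_of_mem_erase hj), hβ j (Finset.ne_of_mem_erase hj)]
  have hn : ∀ j ≠ i, (n + Pi.single i 1 : Fin s → ℤ) j = n j := fun j hj => by simp [hj]
  have hα : ∀ j ≠ i, (α + Pi.single i 1 : Fin s → ℕ) j = α j := fun j hj => by simp [hj]
  rw [h _ _ hn hα, h _ _ (fun _ _ => rfl) hα, h _ _ hn (fun _ _ => rfl), ← sub_mul]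
  congr 1
  simp only [Pi.add_apply, Pi.single_eq_same]
  have := Ring.choose_succ_succ (n i + α i) (α i)
  have e1 : n i + 1 + ((α i + 1 : ℕ) : ℤ) - 1 = n i + α i + 1 := by push_cast; ring
  have e2 : n i + ((α i + 1 : ℕ) : ℤ) - 1 = n i + α i := by push_cast; ring
  have e3 : n i + 1 + (α i : ℤ) - 1 = n i + α i := by ring
  rw [e1, e2, e3, this]
  ring

/-- Pascal's rule lowers α_i by one and terms with α_i = 0 cancel; the signs persist since d and |α|
drop together. The right side is evaluated at n + e_i, so that the step from -e_i to 0 isolates the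
single coefficient at e_i. -/
theorem numericalPoly_add_single_sub (d : ℕ) (e : (Fin s → ℕ) → ℤ) (n : Fin s → ℤ) (i : Fin s) :
    numericalPoly (d + 1) e (n + Pi.single i 1) - numericalPoly (d + 1) e n =
      numericalPoly d (fun α => e (α + Pi.single i 1)) (n + Pi.single i 1) := by
  classical
  rw [numericalPoly_eq, numericalPoly_eq, numericalPoly_eq, ← Finset.sum_sub_distrib]
  simp only [← mul_sub]
  have hsum : ∀ α : Fin s → ℕ,
      ∑ j, (α + Pi.single i 1 : Fin s → ℕ) j = ∑ j, α j + 1 := by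
    intro α
    simp [Finset.sum_add_distrib]
  have hinj : Function.Injective fun α : Fin s → ℕ => α + Pi.single i 1 :=
    fun α β h => add_right_cancel h
  rw [← Finset.sum_subset (s₁ := (degreeLE s d).map ⟨_, hinj⟩), Finset.sum_map]
  · refine Finset.sum_congr rfl fun α _ => ?_
    simp only [Function.Embedding.coeFn_mk]
    rw [multiBinom_pascal, hsum, Nat.add_sub_add_right]
  · intro α hα
    obtain ⟨β, hβ, rfl⟩ := Finset.mem_map.mp hα
    simp only [Function.Embedding.coeFn_mk]
    rw [mem_degreeLE] at hβ ⊢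
    rw [hsum]
    omega
  · intro α hα hα'
    by_cases h : α i = 0
    · rw [multiBinom_add_single_of_eq_zero h, sub_self, mul_zero]
    · refine absurd (Finset.mem_map.mpr ⟨α - Pi.single i 1, ?_, ?_⟩) hα'
      · have hle : α = (α - Pi.single i 1) + Pi.single i 1 := by
          ext j
          by_cases hj : j = i
          · subst hj
            simp only [Pi.add_apply, Pi.sub_apply, Pi.single_eq_same]
            omega
          · simp [hj]
        rw [mem_degreeLE] at hα ⊢
        rw [hle, hsum] at hα
        omega
      · ext j
        simp only [Function.Embedding.coeFn_mk]
        by_cases hj : j = i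
        · subst hj
          simp only [Pi.add_apply, Pi.sub_apply, Pi.single_eq_same]
          omega
        · simp [hj]

/-- At n = 0 a factor with α_i > 0 is binom(α_i - 1, α_i) = 0. -/
theorem numericalPoly_zero_right (d : ℕ) (e : (Fin s → ℕ) → ℤ) :
    numericalPoly d e 0 = (-1) ^ d * e 0 := by
  rw [numericalPoly_eq, Finset.sum_eq_single 0]
  · simp [multiBinom]
  · intro α _ hα
    obtain ⟨i, hi⟩ := Function.ne_iff.mp hα
    refine mul_eq_zero_of_right _ (Finset.prod_eq_zero (Finset.mem_univ i) ?_)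
    obtain ⟨k, hk⟩ := Nat.exists_eq_succ_of_ne_zero hi
    rw [hk]
    have : (0 : Fin s → ℤ) i + ((k + 1 : ℕ) : ℤ) - 1 = (k : ℤ) := by
      rw [Pi.zero_apply]
      push_cast
      ring
    rw [this, Ring.choose_natCast, Nat.choose_succ_self, Nat.cast_zero]
  · intro h
    exact absurd (mem_degreeLE.mpr (by simp)) h

theorem numericalPoly_zero_left (e : (Fin s → ℕ) → ℤ) (n : Fin s → ℤ) :
    numericalPoly 0 e n = e 0 := by
  rw [numericalPoly_eq, Finset.sum_eq_single 0]
  · simp [multiBinom]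
  · intro α hα hα0
    rw [mem_degreeLE] at hα
    refine absurd (funext fun i => ?_) hα0
    have := Finset.single_le_sum (fun j _ => Nat.zero_le (α j)) (Finset.mem_univ i)
    simp only [Pi.zero_apply]
    omega
  · intro h
    exact absurd (mem_degreeLE.mpr (by simp)) h

theorem numericalPoly_add (d : ℕ) (e e' : (Fin s → ℕ) → ℤ) (n : Fin s → ℤ) :
    numericalPoly d (e + e') n = numericalPoly d e n + numericalPoly d e' n := by
  simp only [numericalPoly_eq, ← Finset.sum_add_distrib, Pi.add_apply]
  exact Finset.sum_congr rfl fun α _ => by ring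

theorem numericalPoly_one_add_single_sub (e : (Fin s → ℕ) → ℤ) (n : Fin s → ℤ) (i : Fin s) :
    numericalPoly 1 e (n + Pi.single i 1) - numericalPoly 1 e n = e (Pi.single i 1) := by
  rw [numericalPoly_add_single_sub, numericalPoly_zero_left, zero_add]

theorem numericalPoly_two_second_difference (e : (Fin s → ℕ) → ℤ) (n : Fin s → ℤ)
    (i j : Fin s) :
    numericalPoly 2 e (n + Pi.single i 1 + Pi.single j 1) - numericalPoly 2 e (n + Pi.single i 1) -
      numericalPoly 2 e (n + Pi.single j 1) + numericalPoly 2 e n =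
        e (Pi.single i 1 + Pi.single j 1) := by
  have h1 := numericalPoly_add_single_sub 1 e n j
  have h2 := numericalPoly_add_single_sub 1 e (n + Pi.single i 1) j
  have h3 := numericalPoly_one_add_single_sub (fun α => e (α + Pi.single j 1))
    (n + Pi.single j 1) i
  rw [add_right_comm] at h3
  linarith

/-- A function on `ℤ^s` whose differences are nonpositive in the region `N ≤ n` is antitone
there. -/
theorem le_of_forall_add_single_le {g : (Fin s → ℤ) → ℤ} {N : Fin s → ℤ}
    (h : ∀ n, N ≤ n → ∀ i, g (n + Pi.single i 1) ≤ g n) {n m : Fin s → ℤ} (hn : N ≤ n)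
    (hnm : n ≤ m) : g m ≤ g n := by
  obtain ⟨k, hk⟩ : ∃ k : ℕ, ∑ i, (m i - n i) = k :=
    Int.eq_ofNat_of_zero_le (Finset.sum_nonneg fun i _ => sub_nonneg.mpr (hnm i))
  induction k generalizing n with
  | zero =>
    have h0 := (Finset.sum_eq_zero_iff_of_nonneg
      (fun i _ => sub_nonneg.mpr (hnm i))).mp (by exact_mod_cast hk)
    have : m = n := funext fun i => sub_eq_zero.mp (h0 i (Finset.mem_univ i))
    rw [this]
  | succ k ih =>
    obtain ⟨i, hi⟩ : ∃ i, n i < m i := by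
      by_contra! hall
      have : ∑ i, (m i - n i) ≤ 0 := Finset.sum_nonpos fun i _ => sub_nonpos.mpr (hall i)
      omega
    have hle : n ≤ n + Pi.single i 1 := by
      rw [le_add_iff_nonneg_right, Pi.single_nonneg]
      norm_num
    refine (ih (hn.trans hle) ?_ ?_).trans (h n hn i)
    · intro j
      by_cases hj : j = i
      · subst hj
        simp only [Pi.add_apply, Pi.single_eq_same]
        omega
      · simpa [hj] using hnm j
    · have : ∑ j, (m j - (n + Pi.single i 1 : Fin s → ℤ) j) = ∑ j, (m j - n j) - 1 := by
        simp [Finset.sum_sub_distrib, Finset.sum_add_distrib, sub_sub]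
      rw [this, hk]
      push_cast
      ring

theorem eq_of_forall_add_single_eq {g : (Fin s → ℤ) → ℤ} {N : Fin s → ℤ}
    (h : ∀ n, N ≤ n → ∀ i, g (n + Pi.single i 1) = g n) {n : Fin s → ℤ} (hn : N ≤ n) :
    g n = g N := by
  refine le_antisymm (le_of_forall_add_single_le (fun n hn i => (h n hn i).le) le_rfl hn) ?_
  have := le_of_forall_add_single_le (g := fun n => - g n)
    (fun n hn i => neg_le_neg (h n hn i).ge) le_rfl hn
  exact neg_le_neg_iff.mp this

theorem numericalPoly_indicator_zero (d : ℕ) (z : ℤ) (n : Fin s → ℤ) :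
    numericalPoly d (fun α => if α = 0 then z else 0) n = (-1) ^ d * z := by
  rw [numericalPoly_eq, Finset.sum_eq_single 0]
  · simp [multiBinom]
  · intro α _ hα
    simp [hα]
  · intro h
    exact absurd (mem_degreeLE.mpr (by simp)) h

/-- Existence of the Hilbert polynomial in dimension one. It is needed because the Hilbert
coefficients are a choice that defaults to 0 when there is no such polynomial. -/
theorem exists_numericalPoly_one {H : (Fin s → ℤ) → ℤ} {N : Fin s → ℤ} {c : Fin s → ℤ}
    (h : ∀ n, N ≤ n → ∀ i, H (n + Pi.single i 1) - H n = c i) :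
    ∃ e : (Fin s → ℕ) → ℤ, ∀ n, N ≤ n → numericalPoly 1 e n = H n := by
  let e₀ : (Fin s → ℕ) → ℤ := fun α => ∑ i, α i * c i
  have he₀ : ∀ i, e₀ (Pi.single i 1) = c i := fun i => by
    simp [e₀, Pi.single_apply]
  let z := numericalPoly 1 e₀ N - H N
  refine ⟨e₀ + fun α => if α = 0 then z else 0, fun n hn => ?_⟩
  have h2 : H n - numericalPoly 1 e₀ n = H N - numericalPoly 1 e₀ N :=
    eq_of_forall_add_single_eq (g := fun n => H n - numericalPoly 1 e₀ n) (fun n hn i => by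
      have h3 := numericalPoly_one_add_single_sub e₀ n i
      have h4 := h n hn i
      rw [he₀] at h3
      linarith) hn
  rw [numericalPoly_add, numericalPoly_indicator_zero]
  linarith

/-- The polynomial is built from the top: `e₀` matches the second differences, `e₁` corrects the
remaining constant first differences, and a constant z corrects the value at N. -/
theorem exists_numericalPoly_two {H : (Fin s → ℤ) → ℤ} {N : Fin s → ℤ} {c : Fin s → Fin s → ℤ}
    (h : ∀ n, N ≤ n → ∀ i j, H (n + Pi.single i 1 + Pi.single j 1) - H (n + Pi.single i 1) -
      H (n + Pi.single j 1) + H n = c i j) :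
    ∃ e : (Fin s → ℕ) → ℤ, ∀ n, N ≤ n → numericalPoly 2 e n = H n := by
  -- At α = e_i + e_j this is the second difference of H at N. Being a function of α alone, it
  -- requires no separate proof that c is symmetric.
  let e₀ : (Fin s → ℕ) → ℤ := fun α =>
    H (N + fun i => (α i : ℤ)) - ∑ i, α i * H (N + Pi.single i 1) + H N
  have hcast : ∀ i j : Fin s, (fun k => ((Pi.single i 1 + Pi.single j 1 : Fin s → ℕ) k : ℤ)) =
      Pi.single i 1 + Pi.single j 1 := by
    intro i j
    ext k
    simp [Pi.single_apply]
  have he₀ : ∀ i j, e₀ (Pi.single i 1 + Pi.single j 1) = c i j := by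
    intro i j
    rw [← h N le_rfl i j]
    simp only [e₀]
    rw [hcast, add_assoc]
    have : ∑ k, ((Pi.single i 1 + Pi.single j 1 : Fin s → ℕ) k : ℤ) * H (N + Pi.single k 1) =
        H (N + Pi.single i 1) + H (N + Pi.single j 1) := by
      simp [Pi.single_apply, add_mul, Finset.sum_add_distrib]
    rw [this]
    ring
  let w : Fin s → ℤ := fun i => H (N + Pi.single i 1) - numericalPoly 2 e₀ (N + Pi.single i 1) -
    (H N - numericalPoly 2 e₀ N)
  have hw : ∀ n, N ≤ n → ∀ i, H (n + Pi.single i 1) - numericalPoly 2 e₀ (n + Pi.single i 1) -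
      (H n - numericalPoly 2 e₀ n) = w i := by
    intro n hn i
    refine eq_of_forall_add_single_eq (g := fun n => H (n + Pi.single i 1) -
      numericalPoly 2 e₀ (n + Pi.single i 1) - (H n - numericalPoly 2 e₀ n)) (fun n hn j => ?_) hn
    have h1 := h n hn j i
    have h2 := numericalPoly_two_second_difference e₀ n j i
    rw [he₀] at h2
    linarith
  -- The minus sign compensates (-1)^{2-1} in front of the coefficients with |α| = 1.
  let e₁ : (Fin s → ℕ) → ℤ := fun α => if ∑ i, α i = 1 then -∑ i, α i * w i else 0
  have he₁ : ∀ i n, numericalPoly 2 e₁ (n + Pi.single i 1) - numericalPoly 2 e₁ n = w i := by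
    intro i n
    have hind : (fun α : Fin s → ℕ => e₁ (α + Pi.single i 1)) = fun α => if α = 0 then - w i else 0 := by
      ext α
      have hsum : ∑ j, (α + Pi.single i 1 : Fin s → ℕ) j = ∑ j, α j + 1 := by
        simp [Finset.sum_add_distrib]
      simp only [e₁, hsum]
      by_cases hα : α = 0
      · subst hα
        simp [Pi.single_apply]
      · have : ∑ j, α j ≠ 0 := fun h0 => hα (funext fun j => by
          simpa using (Finset.sum_eq_zero_iff.mp h0) j (Finset.mem_univ j))
        rw [if_neg hα, if_neg (by omega)]
    rw [numericalPoly_add_single_sub, hind, numericalPoly_indicator_zero]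
    ring
  let z := H N - numericalPoly 2 e₀ N - numericalPoly 2 e₁ N
  refine ⟨e₀ + e₁ + fun α => if α = 0 then z else 0, fun n hn => ?_⟩
  have h2 : H n - numericalPoly 2 e₀ n - numericalPoly 2 e₁ n = z :=
    eq_of_forall_add_single_eq
      (g := fun n => H n - numericalPoly 2 e₀ n - numericalPoly 2 e₁ n) (fun n hn i => by
        have h3 := he₁ i n
        have h4 := hw n hn i
        linarith) hn
  rw [numericalPoly_add, numericalPoly_add, numericalPoly_indicator_zero]
  linarith

end NumericalPolynomials

/-! ### From vanishing of H¹ to Ratliff-Rush closedness -/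

section RatliffRush

variable {R : Type*} [CommRing R] {s : ℕ}

theorem multiPow_add (I : Fin s → Ideal R) {n m : Fin s → ℤ} (hn : 0 ≤ n) (hm : 0 ≤ m) :
    multiPow I (n + m) = multiPow I n * multiPow I m := by
  unfold multiPow
  rw [← Finset.prod_mul_distrib]
  refine Finset.prod_congr rfl fun i _ => ?_
  rw [← pow_add, Pi.add_apply, Int.toNat_add (hn i) (hm i)]

theorem IsLaurentHomogeneous.mul {n m : Fin s → ℤ} {f g : LaurentRing R s}
    (hf : IsLaurentHomogeneous n f) (hg : IsLaurentHomogeneous m g) :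
    IsLaurentHomogeneous (n + m) (f * g) := by
  intro k hk
  rw [← Ideal.mem_bot]
  refine laurent_coeff_mul_mem fun a b hab => ?_
  rw [Ideal.mem_bot]
  by_cases ha : a = n
  · rw [hg b (fun hb => hk (by rw [← hab, ha, hb])), mul_zero]
  · rw [hf a ha, zero_mul]

theorem isLaurentHomogeneous_single (n : Fin s → ℤ) (r : R) :
    IsLaurentHomogeneous n (AddMonoidAlgebra.single n r) := by
  intro k hk
  rw [AddMonoidAlgebra.coeff_single, Finsupp.single_eq_of_ne hk]

theorem IsLaurentHomogeneous.pow {n : Fin s → ℤ} {f : LaurentRing R s}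
    (hf : IsLaurentHomogeneous n f) (k : ℕ) : IsLaurentHomogeneous (k • n) (f ^ k) := by
  induction k with
  | zero =>
    rw [pow_zero, zero_smul]
    exact isLaurentHomogeneous_single 0 1
  | succ k ih =>
    rw [pow_succ, succ_nsmul]
    exact ih.mul hf

theorem coeff_pow_mem_truncFamily {I : Fin s → Ideal R} {f : LaurentRing R s}
    (hf : ∀ q, f.coeff q ∈ truncFamily 1 (multiPow I) q) (k : ℕ) (q : Fin s → ℤ) :
    (f ^ k).coeff q ∈ truncFamily (k : Fin s → ℤ) (multiPow I) q := by
  induction k generalizing q with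
  | zero =>
    rw [pow_zero, Nat.cast_zero]
    refine single_coeff_mem (b := truncFamily 0 (multiPow I)) ?_ q
    rw [truncFamily_multiPow_zero]
    trivial
  | succ k ih =>
    rw [pow_succ]
    refine laurent_coeff_mul_mem fun a b hab => ?_
    have h1 := ih a
    have h2 := hf b
    unfold truncFamily at h1 h2 ⊢
    split_ifs at h1 with ha
    · split_ifs at h2 with hb
      · rw [if_pos (by
          rw [← hab]
          push_cast
          exact add_le_add ha hb), ← hab]
        exact multiPow_mul_le I a b (Ideal.mul_mem_mul h1 h2)
      · rw [Ideal.mem_bot.mp h2, mul_zero]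
        exact zero_mem _
    · rw [Ideal.mem_bot.mp h1, zero_mul]
      exact zero_mem _

theorem awayMap_smul_mk {S M : Type*} [CommRing S] [AddCommGroup M] [Module S M] {a c : S}
    (h : a ∣ c) (k : ℕ) (u : M) :
    a ^ k • awayMap M h (LocalizedModule.mk u
      ⟨a ^ k, Submonoid.pow_mem _ (Submonoid.mem_powers a) k⟩) =
        LocalizedModule.mkLinearMap (Submonoid.powers c) M u := by
  have h1 : a ^ k • (LocalizedModule.mk u
      ⟨a ^ k, Submonoid.pow_mem _ (Submonoid.mem_powers a) k⟩ :
        LocalizedModule (Submonoid.powers a) M) = LocalizedModule.mkLinearMap _ M u := by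
    rw [LocalizedModule.smul'_mk]
    exact LocalizedModule.mk_cancel (⟨a ^ k, _⟩ : Submonoid.powers a) u
  rw [← map_smul, h1]
  exact LinearMap.congr_fun (LocalizedModule.lift_comp _ _ (isUnit_algebraMap_away_of_dvd M h)) u

/-- If `H¹` vanishes in degree `n`, then compatible fractions `Uⱼ / xⱼᵏ` of degree `n` come from a
global element. -/
theorem exists_forall_smul_eq_of_cechH1Component_eq_bot {S M G : Type*} [CommRing S]
    [AddCommGroup M] [Module S M] [AddCommGroup G] {m : ℕ} (x : Fin m → S)
    (comp : G → AddSubgroup M) (δ : Fin m → G) {n : G} (hbot : cechH1Component x comp δ n = ⊥)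
    (k : ℕ) (U : Fin m → M) (hU : ∀ j, U j ∈ comp (n + k • δ j))
    (hcomp : ∀ i j, x i ^ k • U j = x j ^ k • U i) :
    ∃ u : M, ∀ j, ∃ l : ℕ, x j ^ l • x j ^ k • u = x j ^ l • U j := by
  let c : ∀ j, LocalizedModule (Submonoid.powers (x j)) M := fun j =>
    LocalizedModule.mk (U j) ⟨x j ^ k, Submonoid.pow_mem _ (Submonoid.mem_powers _) k⟩
  have hc : c ∈ LinearMap.ker (cechD1 M x) := by
    rw [LinearMap.mem_ker]
    ext1 ⟨⟨i, j⟩, hij⟩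
    change awayMap M (Dvd.intro_left (x i) rfl) (c j) - awayMap M (Dvd.intro (x j) rfl) (c i) = 0
    rw [sub_eq_zero]
    -- Multiplication by (x_i x_j)ᵏ is injective on the localization and clears both denominators,
    -- which reduces the cocycle condition to `hcomp`.
    refine IsLocalizedModule.smul_injective
      (LocalizedModule.mkLinearMap (Submonoid.powers (x i * x j)) M)
      ⟨(x i * x j) ^ k, Submonoid.pow_mem _ (Submonoid.mem_powers _) k⟩ ?_
    change (x i * x j) ^ k • awayMap M (Dvd.intro_left (x i) rfl) (c j) =
      (x i * x j) ^ k • awayMap M (Dvd.intro (x j) rfl) (c i)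
    rw [mul_pow, mul_smul, awayMap_smul_mk, mul_comm (x i ^ k), mul_smul, awayMap_smul_mk, ← map_smul,
      ← map_smul, hcomp]
  have hzero : (Submodule.Quotient.mk ⟨c, hc⟩ : CechH1 M x) = 0 := by
    rw [← AddSubgroup.mem_bot, ← hbot]
    exact AddSubgroup.subset_closure ⟨⟨c, hc⟩, fun j => ⟨k, U j, hU j, rfl⟩, rfl⟩
  rw [Submodule.Quotient.mk_eq_zero] at hzero
  obtain ⟨u, hu⟩ := hzero
  refine ⟨u, fun j => ?_⟩
  have h1 : LocalizedModule.mk u 1 = c j := congrFun hu j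
  obtain ⟨⟨_, l, rfl⟩, hl⟩ := LocalizedModule.mk_eq.mp h1
  refine ⟨l, hl.trans ?_⟩
  exact congrArg _ (one_smul _ _)

/-- If the component of degree `n ≥ 0` of `H¹` vanishes, then `F(n)` is Ratliff-Rush closed. -/
theorem MultiFiltration.mem_of_cechH1Component_eq_bot {I : Fin s → Ideal R}
    (F : MultiFiltration I) (hreg : ∃ a ∈ multiPow I 1, a ∈ nonZeroDivisors R)
    {m : ℕ} (x : Fin m → reesRing I) (δ : Fin m → (Fin s → ℤ))
    (hhom : ∀ j, IsLaurentHomogeneous (δ j) (x j : LaurentRing R s))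
    (hspan : Ideal.span (Set.range x) = reesIrrelevant I) {n : Fin s → ℤ} (hn : 0 ≤ n)
    (hbot : cechH1Component (M := reesModule F) x (reesComponent F) δ n = ⊥) {r : R} (k : ℕ)
    (hr : ∀ u ∈ multiPow I (k : Fin s → ℤ), u * r ∈ F.ideal (n + k)) : r ∈ F.ideal n := by
  have hx : ∀ j q, (x j : LaurentRing R s).coeff q ∈ truncFamily 1 (multiPow I) q := by
    intro j
    have : x j ∈ reesIrrelevant I := hspan ▸ Ideal.subset_span ⟨j, rfl⟩
    exact this
  -- The condition spreads from degree (k,…,k) to all q ≥ (k,…,k), so r tⁿ x_jᵏ lies in R(F)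
  -- whatever the degree of x_j. The fractions r tⁿ x_jᵏ / x_jᵏ thus form a cocycle of degree n.
  have hr' : ∀ q, (k : Fin s → ℤ) ≤ q → ∀ u ∈ multiPow I q, u * r ∈ F.ideal (n + q) := by
    intro q hq u hu
    have hk0 : (0 : Fin s → ℤ) ≤ k := fun i => by simp
    rw [← sub_add_cancel q (k : Fin s → ℤ), multiPow_add I (sub_nonneg.mpr hq) hk0] at hu
    have hle : multiPow I (q - k) * multiPow I (k : Fin s → ℤ) * Ideal.span {r} ≤
        F.ideal (n + q) := by
      have h1 : multiPow I (k : Fin s → ℤ) * Ideal.span {r} ≤ F.ideal (n + k) := by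
        rw [Ideal.mul_le]
        intro v hv t ht
        obtain ⟨t, rfl⟩ := Ideal.mem_span_singleton.mp ht
        rw [← mul_assoc]
        exact Ideal.mul_mem_right _ _ (hr v hv)
      rw [mul_assoc]
      refine (Ideal.mul_mono_right h1).trans ((F.multiPow_mul_ideal_le _ _).trans_eq ?_)
      congr 1
      abel
    exact hle (Ideal.mul_mem_mul hu (Ideal.mem_span_singleton_self r))
  have hU : ∀ j, AddMonoidAlgebra.single n r * (x j : LaurentRing R s) ^ k ∈ reesModule F := by
    intro j q
    rw [coeff_single_mul]
    have h1 := coeff_pow_mem_truncFamily (hx j) k (q - n)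
    unfold truncFamily at h1 ⊢
    split_ifs at h1 with hq
    · have h2 := hr' _ hq _ h1
      have hq0 : 0 ≤ q := by
        have hk0 : (0 : Fin s → ℤ) ≤ k := fun i => by simp
        have := add_nonneg (hk0.trans hq) hn
        rwa [sub_add_cancel] at this
      rw [if_pos hq0]
      rwa [add_sub_cancel, mul_comm] at h2
    · rw [Ideal.mem_bot.mp h1, mul_zero]
      exact zero_mem _
  let U : Fin m → reesModule F := fun j => ⟨_, hU j⟩
  obtain ⟨u, hu⟩ := exists_forall_smul_eq_of_cechH1Component_eq_bot x (reesComponent F) δ hbot k U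
    (fun j => (isLaurentHomogeneous_single n r).mul ((hhom j).pow k)) (fun i j => by
      apply Subtype.ext
      change ((x i ^ k : reesRing I) : LaurentRing R s) * (_ * (x j : LaurentRing R s) ^ k) =
        ((x j ^ k : reesRing I) : LaurentRing R s) * (_ * (x i : LaurentRing R s) ^ k)
      rw [SubmonoidClass.coe_pow, SubmonoidClass.coe_pow]
      ring)
  -- The cocycle is the boundary of some u in R(F). Then u - r tⁿ is killed by a power of each x_j,
  -- and it remains to see that it is zero.
  set f : LaurentRing R s := (u : LaurentRing R s) - AddMonoidAlgebra.single n r with hf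
  let ann : Ideal (reesRing I) :=
    LinearMap.ker (LinearMap.toSpanSingleton (reesRing I) (LaurentRing R s) f)
  have hann : ∀ w : reesRing I, w ∈ ann ↔ (w : LaurentRing R s) * f = 0 := fun w => Iff.rfl
  have hrad : reesIrrelevant I ≤ ann.radical := by
    rw [← hspan, Ideal.span_le]
    rintro _ ⟨j, rfl⟩
    obtain ⟨l, hl⟩ := hu j
    refine ⟨l + k, (hann _).mpr ?_⟩
    have h2 : ((x j ^ l : reesRing I) : LaurentRing R s) *
        (((x j ^ k : reesRing I) : LaurentRing R s) * u) =
          ((x j ^ l : reesRing I) : LaurentRing R s) *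
            (AddMonoidAlgebra.single n r * (x j : LaurentRing R s) ^ k) :=
      congrArg Subtype.val hl
    rw [SubmonoidClass.coe_pow, SubmonoidClass.coe_pow] at h2
    rw [SubmonoidClass.coe_pow, hf, pow_add]
    linear_combination h2
  -- The element a t^{(1,…,1)} lies in R(I)₊₊, so some power of it kills f; as a is a
  -- nonzerodivisor, f = 0 and r is the coefficient of u in degree n.
  obtain ⟨a, haI, ha⟩ := hreg
  have hw : ∀ q, (AddMonoidAlgebra.single 1 a : LaurentRing R s).coeff q ∈
      truncFamily 1 (multiPow I) q := single_coeff_mem (by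
    unfold truncFamily
    rwa [if_pos le_rfl])
  have hw' : AddMonoidAlgebra.single 1 a ∈ reesRing I := by
    intro q
    have := hw q
    unfold truncFamily at this ⊢
    split_ifs at this with hq
    · rwa [if_pos (zero_le_one.trans hq)]
    · rw [Ideal.mem_bot.mp this]
      exact zero_mem _
  obtain ⟨q, hq⟩ := hrad (show (⟨_, hw'⟩ : reesRing I) ∈ reesIrrelevant I from hw)
  rw [hann, SubmonoidClass.coe_pow] at hq
  have hq' : AddMonoidAlgebra.single (q • 1) (a ^ q) * f = 0 := by
    rw [← AddMonoidAlgebra.single_pow]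
    exact hq
  have hf0 : f = 0 := by
    refine AddMonoidAlgebra.ext (Finsupp.ext fun p => ?_)
    have h1 := congrArg (fun g : LaurentRing R s => g.coeff (p + q • 1)) hq'
    simp only [coeff_single_mul, add_sub_cancel_right, AddMonoidAlgebra.coeff_zero,
      Finsupp.coe_zero, Pi.zero_apply] at h1
    exact (mul_left_mem_nonZeroDivisors_eq_zero_iff (pow_mem ha q)).mp h1
  have h3 := u.2 n
  rw [sub_eq_zero.mp (hf.symm.trans hf0), AddMonoidAlgebra.coeff_single,
    Finsupp.single_eq_same] at h3
  unfold truncFamily at h3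
  rwa [if_pos hn] at h3

end RatliffRush

/-! ### Differences of the Hilbert function, and the comparison with the Hilbert polynomial -/

section HilbertFunction

variable {R : Type*} [CommRing R] {s : ℕ} {I : Fin s → Ideal R} (F : MultiFiltration I)

theorem MultiFiltration.ideal_eq_top_of_nonpos {n : Fin s → ℤ} (hn : n ≤ 0) : F.ideal n = ⊤ :=
  top_le_iff.mp ((multiPow_of_nonpos I hn).symm.le.trans (F.multiPow_le n))

theorem MultiFiltration.hilbertFunction_eq_zero {n : Fin s → ℤ} (hn : n ≤ 0) :
    F.hilbertFunction n = 0 := by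
  have : Module.length R (R ⧸ F.ideal n) = 0 := by
    rw [F.ideal_eq_top_of_nonpos hn, Module.length_eq_zero_iff, Ideal.Quotient.subsingleton_iff]
  rw [MultiFiltration.hilbertFunction, this]
  rfl

theorem MultiFiltration.IsAdmissible.isFiniteFamily {F : MultiFiltration I}
    (hF : F.IsAdmissible) : IsFiniteFamily I F.ideal :=
  isFiniteFamily_of_fg F.multiPow_mul_ideal_le (Module.Finite.iff_fg.mp hF.2)

theorem MultiFiltration.isHilbertCoeff_hilbertCoeff {d : ℕ} (h : ∃ e, F.IsHilbertCoeff d e) :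
    F.IsHilbertCoeff d (F.hilbertCoeff d) := by
  unfold MultiFiltration.hilbertCoeff
  rw [dif_pos h]
  exact h.choose_spec

theorem span_singleton_mul_ideal_le {i : Fin s} {a : R} (ha : a ∈ I i) (n : Fin s → ℤ) :
    Ideal.span {a} * F.ideal n ≤ F.ideal (n + Pi.single i 1) := by
  rw [add_comm]
  refine le_trans (Ideal.mul_mono_left ?_) (F.multiPow_mul_ideal_le _ _)
  rwa [multiPow_single_one, Ideal.span_singleton_le_iff_mem]

variable [IsLocalRing R]

theorem exists_pow_le_multiPow (hmI : ∀ i, ∃ k, maximalIdeal R ^ k ≤ I i) (n : Fin s → ℤ) :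
    ∃ k, maximalIdeal R ^ k ≤ multiPow I n := by
  choose k hk using hmI
  refine ⟨∑ i, k i * (n i).toNat, ?_⟩
  rw [← Finset.prod_pow_eq_pow_sum]
  refine Finset.prod_le_prod' fun i _ => ?_
  rw [pow_mul]
  exact Ideal.pow_right_mono (hk i) _

variable [IsNoetherianRing R]

theorem MultiFiltration.coe_hilbertFunction (hmI : ∀ i, ∃ k, maximalIdeal R ^ k ≤ I i) :
    ∃ h : (Fin s → ℤ) → ℕ, ∀ n, Module.length R (R ⧸ F.ideal n) = h n ∧
      F.hilbertFunction n = h n := by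
  refine ⟨fun n => (Module.length R (R ⧸ F.ideal n)).toNat, fun n => ⟨?_, rfl⟩⟩
  obtain ⟨k, hk⟩ := exists_pow_le_multiPow hmI n
  rw [ENat.natCast_toNat (length_quotient_ne_top ⟨k, hk.trans (F.multiPow_le n)⟩)]

variable [Infinite (ResidueField R)]

/-- In dimension one, the first differences of the Hilbert function are bounded by their
eventual value. -/
theorem MultiFiltration.exists_hilbertFunction_difference (hdim : ringKrullDim R = 1)
    (hdepth : maximalIdeal R ∉ associatedPrimes R R) (hIm : ∀ i, I i ≤ maximalIdeal R)
    (hmI : ∀ i, ∃ k, maximalIdeal R ^ k ≤ I i) (hF : F.IsAdmissible) (i : Fin s) :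
    ∃ c p : ℤ, (∀ n, F.hilbertFunction (n + Pi.single i 1) - F.hilbertFunction n ≤ c) ∧
      ∀ n : Fin s → ℤ, p ≤ n i →
        F.hilbertFunction (n + Pi.single i 1) - F.hilbertFunction n = c := by
  obtain ⟨a, haI, ha, hk, p, hp⟩ := exists_principal_reduction hdim hdepth hIm hmI
    F.multiPow_mul_ideal_le hF.isFiniteFamily (fun _ => F.ideal_eq_top_of_nonpos) i
  obtain ⟨h, hh⟩ := F.coe_hilbertFunction hmI
  obtain ⟨c, hc⟩ := ENat.ne_top_iff_exists.mp (length_quotient_ne_top hk)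
  have hlen : ∀ n, Module.length R (R ⧸ (Ideal.span {a} * F.ideal n)) = ((c + h n : ℕ) : ℕ∞) := by
    intro n
    rw [length_quotient_span_mul ha, ← hc, (hh n).1]
    norm_cast
  -- Here c = λ(R/a). The inclusion a F(n) ⊆ F(n + e_i) gives the bound for all n, and its equality
  -- for n_i ≥ p gives the value.
  refine ⟨c, p, fun n => ?_, fun n hn => ?_⟩
  · have h1 := length_quotient_anti (span_singleton_mul_ideal_le F haI n)
    rw [hlen, (hh _).1] at h1
    rw [(hh _).2, (hh _).2]
    have h2 : h (n + Pi.single i 1) ≤ c + h n := by exact_mod_cast h1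
    omega
  · have h1 := hlen n
    rw [le_antisymm (span_singleton_mul_ideal_le F haI n) (hp n hn), (hh _).1] at h1
    rw [(hh _).2, (hh _).2]
    have h2 : h (n + Pi.single i 1) = c + h n := by exact_mod_cast h1
    omega

/-- The degree-`n` component `F(n)` is Ratliff-Rush closed. -/
def MultiFiltration.IsRatliffRushClosedAt (n : Fin s → ℤ) : Prop :=
  ∀ (r : R) (k : ℕ), (∀ u ∈ multiPow I (k : Fin s → ℤ), u * r ∈ F.ideal (n + k)) → r ∈ F.ideal n

/-- In a two-dimensional Cohen-Macaulay ring, the second differences of the Hilbert function are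
bounded by their eventual value wherever the filtration is Ratliff-Rush closed. -/
theorem MultiFiltration.exists_hilbertFunction_second_difference (hdim : ringKrullDim R = 2)
    (hCM : IsCohenMacaulayLocal R) (hIm : ∀ i, I i ≤ maximalIdeal R)
    (hmI : ∀ i, ∃ k, maximalIdeal R ^ k ≤ I i) (hF : F.IsAdmissible) (i j : Fin s) :
    ∃ c p : ℤ, (∀ n, F.IsRatliffRushClosedAt n →
      F.hilbertFunction (n + Pi.single i 1 + Pi.single j 1) -
        F.hilbertFunction (n + Pi.single i 1) - F.hilbertFunction (n + Pi.single j 1) +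
          F.hilbertFunction n ≤ c) ∧
      ∀ n : Fin s → ℤ, p ≤ n i → p ≤ n j →
        F.hilbertFunction (n + Pi.single i 1 + Pi.single j 1) -
          F.hilbertFunction (n + Pi.single i 1) - F.hilbertFunction (n + Pi.single j 1) +
            F.hilbertFunction n = c := by
  obtain ⟨a, haI, b, hbI, ha, hab, hk, p, hcol, hp⟩ := exists_joint_reduction hdim hCM hIm hmI
    F.multiPow_mul_ideal_le hF.isFiniteFamily (fun _ => F.ideal_eq_top_of_nonpos) i j
  obtain ⟨h, hh⟩ := F.coe_hilbertFunction hmI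
  obtain ⟨c, hc⟩ := ENat.ne_top_iff_exists.mp (length_quotient_ne_top hk)
  have hle : ∀ n : Fin s → ℤ, Ideal.span {a} * F.ideal (n + Pi.single j 1) ⊔
      Ideal.span {b} * F.ideal (n + Pi.single i 1) ≤
        F.ideal (n + Pi.single i 1 + Pi.single j 1) := by
    intro n
    refine sup_le ?_ (span_singleton_mul_ideal_le F hbI _)
    rw [add_right_comm]
    exact span_singleton_mul_ideal_le F haI _
  have hlen : ∀ n : Fin s → ℤ, (∀ x, a * x ∈ F.ideal (n + Pi.single i 1) →
      b * x ∈ F.ideal (n + Pi.single j 1) → x ∈ F.ideal n) →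
      Module.length R (R ⧸ (Ideal.span {a} * F.ideal (n + Pi.single j 1) ⊔
        Ideal.span {b} * F.ideal (n + Pi.single i 1))) + (h n : ℕ∞) =
          ((c + (h (n + Pi.single j 1) + h (n + Pi.single i 1)) : ℕ) : ℕ∞) := by
    intro n hn
    have h1 := length_quotient_span_mul_sup_span_mul ha hab (F.ideal (n + Pi.single j 1))
      (F.ideal (n + Pi.single i 1))
    have h2 : Submodule.comap (LinearMap.mulLeft R b) (F.ideal (n + Pi.single j 1)) ⊓
        Submodule.comap (LinearMap.mulLeft R a) (F.ideal (n + Pi.single i 1)) = F.ideal n := by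
      refine le_antisymm (fun x hx => hn x hx.2 hx.1) fun x hx => ⟨?_, ?_⟩
      · exact span_singleton_mul_ideal_le F hbI n
          (Ideal.mul_mem_mul (Ideal.mem_span_singleton_self b) hx)
      · exact span_singleton_mul_ideal_le F haI n
          (Ideal.mul_mem_mul (Ideal.mem_span_singleton_self a) hx)
    rw [h2, (hh _).1, (hh _).1, (hh _).1, ← hc] at h1
    rw [h1]
    norm_cast
  refine ⟨c, p, fun n hn => ?_, fun n hni hnj => ?_⟩
  · have h1 := hlen n (by
      intro x hax hbx
      -- With K = (k,…,k) and k ≥ p + 2, the degree K - e_i - e_j is still at least p in coordinates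
      -- i and j, even when i = j. So F(K) = a F(K - e_i) + b F(K - e_j), and ax in F(n + e_i), bx
      -- in F(n + e_j) give x F(K) ⊆ F(n + K).
      refine hn x (p + 2).toNat fun u hu => ?_
      set K : Fin s → ℤ := ((p + 2).toNat : Fin s → ℤ) with hK
      have hKl : ∀ l, p + 2 ≤ K l := fun l => by
        rw [hK, Pi.natCast_apply]
        exact Int.self_le_toNat _
      have hs : ∀ l l', (Pi.single l 1 : Fin s → ℤ) l' ≤ 1 := fun l l' => by
        rw [Pi.single_apply]
        split_ifs <;> norm_num
      have hu' := F.multiPow_le _ hu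
      have e0 : K = K - Pi.single i 1 - Pi.single j 1 + Pi.single i 1 + Pi.single j 1 := by abel
      rw [e0] at hu'
      obtain ⟨y, hy, z, hz, rfl⟩ := Submodule.mem_sup.mp (hp _
        (by
          have := hKl i; have := hs i i; have := hs j i
          simp only [Pi.sub_apply]
          omega)
        (by
          have := hKl j; have := hs i j; have := hs j j
          simp only [Pi.sub_apply]
          omega) hu')
      obtain ⟨y, hy', rfl⟩ := Ideal.mem_span_singleton_mul.mp hy
      obtain ⟨z, hz', rfl⟩ := Ideal.mem_span_singleton_mul.mp hz
      have h3 := F.mul_le _ _ (Ideal.mul_mem_mul hax hy')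
      have h4 := F.mul_le _ _ (Ideal.mul_mem_mul hbx hz')
      have e1 : n + Pi.single i 1 + (K - Pi.single i 1 - Pi.single j 1 + Pi.single j 1) = n + K := by
        abel
      have e2 : n + Pi.single j 1 + (K - Pi.single i 1 - Pi.single j 1 + Pi.single i 1) = n + K := by
        abel
      rw [e1] at h3
      rw [e2] at h4
      convert add_mem h3 h4 using 1
      ring)
    have h2 := add_le_add_left (length_quotient_anti (hle n)) (h n : ℕ∞)
    rw [h1, (hh _).1] at h2
    have h3 : h (n + Pi.single i 1 + Pi.single j 1) + h n ≤
        c + (h (n + Pi.single j 1) + h (n + Pi.single i 1)) := by exact_mod_cast h2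
    simp only [(hh _).2]
    omega
  · have h1 := hlen n fun x hx _ => hcol n hni x hx
    rw [le_antisymm (hle n) (hp n hni hnj), (hh _).1] at h1
    have h3 : h (n + Pi.single i 1 + Pi.single j 1) + h n =
        c + (h (n + Pi.single j 1) + h (n + Pi.single i 1)) := by exact_mod_cast h1
    simp only [(hh _).2]
    omega

/-- H - P is antitone on ℕ^s because the difference of P in direction i is the eventual difference
of H. It is 0 at the origin since e_0 = 0, and 0 far out. -/
theorem MultiFiltration.hilbertPoly_one_eq (hdim : ringKrullDim R = 1)
    (hdepth : maximalIdeal R ∉ associatedPrimes R R) (hIm : ∀ i, I i ≤ maximalIdeal R)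
    (hmI : ∀ i, ∃ k, maximalIdeal R ^ k ≤ I i) (hF : F.IsAdmissible)
    (he : F.hilbertCoeff 1 0 = 0) {n : Fin s → ℤ} (hn : 0 ≤ n) :
    F.hilbertPoly 1 n = F.hilbertFunction n := by
  choose c p hle heq using F.exists_hilbertFunction_difference hdim hdepth hIm hmI hF
  obtain ⟨N, hN⟩ := F.isHilbertCoeff_hilbertCoeff (d := 1) (by
    obtain ⟨e, he⟩ := exists_numericalPoly_one (N := p) fun n hn i => heq i n (hn i)
    exact ⟨e, p, he⟩)
  have hstep : ∀ n i, N ≤ n → N ≤ n + Pi.single i 1 := fun n i hn =>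
    hn.trans (le_add_of_nonneg_right (Pi.single_nonneg.mpr zero_le_one))
  have hce : ∀ i, F.hilbertCoeff 1 (Pi.single i 1) = c i := by
    intro i
    have h1 := numericalPoly_one_add_single_sub (F.hilbertCoeff 1) (N ⊔ p) i
    rw [hN _ (hstep _ _ le_sup_left), hN _ le_sup_left,
      heq i _ ((le_sup_right : p ≤ N ⊔ p) i)] at h1
    exact h1.symm
  have hG : ∀ n, 0 ≤ n → ∀ i,
      F.hilbertFunction (n + Pi.single i 1) - F.hilbertPoly 1 (n + Pi.single i 1) ≤
        F.hilbertFunction n - F.hilbertPoly 1 n := by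
    intro n _ i
    have h1 := numericalPoly_one_add_single_sub (F.hilbertCoeff 1) n i
    have h2 := hle i n
    rw [hce] at h1
    unfold MultiFiltration.hilbertPoly
    linarith
  have h0 : F.hilbertFunction 0 - F.hilbertPoly 1 0 = 0 := by
    rw [F.hilbertFunction_eq_zero le_rfl, MultiFiltration.hilbertPoly, numericalPoly_zero_right, he]
    ring
  have h1 := le_of_forall_add_single_le
    (g := fun n => F.hilbertFunction n - F.hilbertPoly 1 n) hG le_rfl hn
  have h2 := le_of_forall_add_single_le
    (g := fun n => F.hilbertFunction n - F.hilbertPoly 1 n) hG hn (le_sup_left : n ≤ n ⊔ N)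
  have h3 : F.hilbertPoly 1 (n ⊔ N) = F.hilbertFunction (n ⊔ N) := hN _ le_sup_right
  simp only [h0, h3, sub_self] at h1 h2
  linarith

/-- The second differences of H - P are nonpositive on ℕ^s, so its first differences decrease to
their eventual value 0; the condition on the coefficients at e_i makes them nonpositive at the
origin. -/
theorem MultiFiltration.hilbertPoly_two_eq (hdim : ringKrullDim R = 2)
    (hCM : IsCohenMacaulayLocal R) (hIm : ∀ i, I i ≤ maximalIdeal R)
    (hmI : ∀ i, ∃ k, maximalIdeal R ^ k ≤ I i) (hF : F.IsAdmissible)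
    (he : ∀ i, F.hilbertCoeff 2 (Pi.single i 1) = 0)
    (hRR : ∀ n, 0 ≤ n → F.IsRatliffRushClosedAt n) :
    (∀ n, 0 ≤ n → F.hilbertPoly 2 n = F.hilbertFunction n) ∧ F.hilbertCoeff 2 0 = 0 := by
  choose c p hle heq using F.exists_hilbertFunction_second_difference hdim hCM hIm hmI hF
  obtain ⟨B, hB⟩ : ∃ B, ∀ i j, p i j ≤ B := by
    obtain ⟨B, hB⟩ := (Set.finite_range fun q : Fin s × Fin s => p q.1 q.2).bddAbove
    exact ⟨B, fun i j => hB ⟨(i, j), rfl⟩⟩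
  have heq' : ∀ n : Fin s → ℤ, (fun _ => B) ≤ n → ∀ i j, _ := fun n hn i j =>
    heq i j n ((hB i j).trans (hn i)) ((hB i j).trans (hn j))
  obtain ⟨N, hN⟩ := F.isHilbertCoeff_hilbertCoeff (d := 2) (by
    obtain ⟨e, he⟩ := exists_numericalPoly_two heq'
    exact ⟨e, _, he⟩)
  have hstep : ∀ n i, n ≤ n + (Pi.single i 1 : Fin s → ℤ) := fun n i =>
    le_add_of_nonneg_right (Pi.single_nonneg.mpr zero_le_one)
  have hce : ∀ i j, F.hilbertCoeff 2 (Pi.single i 1 + Pi.single j 1) = c i j := by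
    intro i j
    have h1 := numericalPoly_two_second_difference (F.hilbertCoeff 2) (N ⊔ fun _ => B) i j
    have h0 : N ≤ N ⊔ fun _ => B := le_sup_left
    rw [hN _ h0, hN _ (h0.trans (hstep _ i)), hN _ (h0.trans (hstep _ j)),
      hN _ (h0.trans ((hstep _ i).trans (hstep _ j))), heq' _ le_sup_right] at h1
    exact h1.symm
  obtain ⟨G, hG⟩ : ∃ G : (Fin s → ℤ) → ℤ, ∀ n, G n = F.hilbertFunction n - F.hilbertPoly 2 n :=
    ⟨_, fun _ => rfl⟩
  have hGN : ∀ n, N ≤ n → G n = 0 := fun n hn => by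
    rw [hG, sub_eq_zero]
    exact (hN n hn).symm
  have hGd : ∀ n, F.IsRatliffRushClosedAt n → ∀ i j,
      G (n + Pi.single j 1 + Pi.single i 1) - G (n + Pi.single j 1) ≤
        G (n + Pi.single i 1) - G n := by
    intro n hn i j
    have h1 := numericalPoly_two_second_difference (F.hilbertCoeff 2) n i j
    have h2 := hle i j n hn
    rw [hce, add_right_comm] at h1
    rw [add_right_comm] at h2
    simp only [hG, MultiFiltration.hilbertPoly]
    linarith
  have hGi : ∀ n, 0 ≤ n → ∀ i, G (n + Pi.single i 1) - G n = 0 := by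
    intro n hn i
    have hanti : ∀ n m, 0 ≤ n → n ≤ m → G (m + Pi.single i 1) - G m ≤ G (n + Pi.single i 1) - G n :=
      fun n m hn hnm => le_of_forall_add_single_le (N := 0)
        (g := fun n => G (n + Pi.single i 1) - G n) (fun n hn j => hGd n (hRR n hn) i j) hn hnm
    refine le_antisymm ((hanti _ _ le_rfl hn).trans ?_) ?_
    · have hneg : -(Pi.single i 1 : Fin s → ℤ) ≤ 0 :=
        neg_nonpos.mpr (Pi.single_nonneg.mpr zero_le_one)
      -- The bound also applies at -e_i, where F is the unit ideal and hence trivially Ratliff-Rush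
      -- closed. There H(-e_i) = H(0) = 0, while P(0) - P(-e_i) is minus the coefficient at e_i,
      -- which is zero.
      have h1 := hGd (-Pi.single i 1)
        (fun r _ _ => by
          rw [F.ideal_eq_top_of_nonpos hneg]
          trivial) i i
      have h2 : numericalPoly 2 (F.hilbertCoeff 2) (-Pi.single i 1 + Pi.single i 1) -
          numericalPoly 2 (F.hilbertCoeff 2) (-Pi.single i 1) = _ :=
        numericalPoly_add_single_sub 1 (F.hilbertCoeff 2) (-Pi.single i 1) i
      rw [neg_add_cancel, numericalPoly_zero_right 1] at h2
      simp only [zero_add, he, mul_zero] at h2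
      rw [neg_add_cancel] at h1
      refine h1.trans ?_
      simp only [hG, MultiFiltration.hilbertPoly, F.hilbertFunction_eq_zero hneg,
        F.hilbertFunction_eq_zero le_rfl]
      linarith
    · have h1 := hanti _ _ hn (le_sup_left : n ≤ n ⊔ N)
      simp only [hGN _ le_sup_right, hGN _ ((le_sup_right : N ≤ n ⊔ N).trans (hstep _ i))] at h1
      simpa using h1
  have hG0 : ∀ n, 0 ≤ n → G n = G 0 := fun n hn =>
    eq_of_forall_add_single_eq (fun n hn i => sub_eq_zero.mp (hGi n hn i)) hn
  have h00 : G 0 = 0 := (hG0 (0 ⊔ N) le_sup_left).symm.trans (hGN _ le_sup_right)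
  refine ⟨fun n hn => (sub_eq_zero.mp ((hG n).symm.trans ((hG0 n hn).trans h00))).symm, ?_⟩
  have h1 : F.hilbertFunction 0 - F.hilbertPoly 2 0 = 0 := (hG 0).symm.trans h00
  rw [F.hilbertFunction_eq_zero le_rfl, MultiFiltration.hilbertPoly, numericalPoly_zero_right] at h1
  linarith

end HilbertFunction

end

/-! ### The theorem -/

theorem theorem4p5 {R : Type*} [CommRing R] [IsLocalRing R] [IsNoetherianRing R]
    (hCM : IsCohenMacaulayLocal R)
    (hres : Infinite (IsLocalRing.ResidueField R))
    (d : ℕ) (hd : ringKrullDim R = d) (hd1 : 1 ≤ d) (hd2 : d ≤ 2)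
    (s : ℕ) (hs : 1 ≤ s) (I : Fin s → Ideal R)
    (hI : ∀ i, (I i).radical = IsLocalRing.maximalIdeal R)
    (F : MultiFiltration I) (hF : F.IsAdmissible)
    (he : ∀ i : Fin s, F.hilbertCoeff d (Pi.single i (d - 1)) = 0) :
    (d = 1 → ∀ n : Fin s → ℤ, 0 ≤ n → F.hilbertPoly d n = F.hilbertFunction n) ∧
    (d = 2 →
      -- the local cohomology with support in `R(I)₊₊` is computed on an arbitrary finite system
      -- of homogeneous generators of this ideal
      ∀ (m : ℕ) (x : Fin m → reesRing I) (δ : Fin m → (Fin s → ℤ)),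
        (∀ j, IsLaurentHomogeneous (δ j) (x j : LaurentRing R s)) →
        Ideal.span (Set.range x) = reesIrrelevant I →
        (∀ n : Fin s → ℤ, 0 ≤ n →
          cechH1Component (M := reesModule F) x (reesComponent F) δ n = ⊥) →
        (∀ n : Fin s → ℤ, 0 ≤ n → F.hilbertPoly d n = F.hilbertFunction n) ∧
          F.hilbertCoeff d 0 = 0) := by
  have hIm : ∀ i, I i ≤ maximalIdeal R := fun i => (hI i).le.trans' Ideal.le_radical
  have hmI : ∀ i, ∃ k, maximalIdeal R ^ k ≤ I i := fun i =>
    Ideal.exists_pow_le_of_le_radical_of_fg (hI i).ge (IsNoetherian.noetherian _)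
  obtain ⟨y, hy, hyreg⟩ := hCM.exists_nonZeroDivisor hd hd1
  refine ⟨?_, ?_⟩
  · rintro rfl n hn
    refine F.hilbertPoly_one_eq (by simpa using hd)
      (maximalIdeal_notMem_associatedPrimes ⟨y, hy, hyreg⟩) hIm hmI hF ?_ hn
    -- For d = 1 the index (d - 1)e_i is 0 for each i; s ≥ 1 provides one such i.
    simpa using he ⟨0, hs⟩
  · rintro rfl m x δ hhom hspan hbot
    refine F.hilbertPoly_two_eq (by simpa using hd) hCM hIm hmI hF he fun n hn r k hr => ?_
    -- A power of the nonzerodivisor y in 𝔪 lies in the 𝔪-primary ideal I_1⋯I_s.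
    obtain ⟨q, hq⟩ := exists_pow_le_multiPow hmI 1
    exact F.mem_of_cechH1Component_eq_bot
      ⟨y ^ q, hq (Ideal.pow_mem_pow hy q), pow_mem hyreg q⟩ x δ hhom hspan hn (hbot n hn) k hr
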